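/- Let $n,m\ge 1$ and let $P(x,y)=(P_1(x,y),\dots,P_n(x,y))$ be a vector of real polynomials with non-negative coefficients and total degree at most $2$ in the coordinates of $x=(x_1,\dots,x_n)$ and $y=(y_1,\dots,y_m)$. All vector inequalities are coordinatewise, $v>0$ means that every coordinate is positive, $\log$ is to base $2$, and the least fixed point (LFP) of a system $x=Q(x)$ is the least solution in $\mathbb{R}^n_{\ge 0}$. Let $y^{(1)},y^{(2)}\in\mathbb{R}^m$ with $0<y^{(1)}\le\mathbf 1$ and $0\le y^{(2)}\le y^{(1)}$, and put $P^{(1)}(x)=P(x,y^{(1)})$ and $P^{(2)}(x)=P(x,y^{(2)})$. Suppose that $x=P^{(1)}(x)$ is strongly connected, i.e. the directed graph on $\{1,\dots,n\}$ with an edge $i\to j$ whenever $x_j$ occurs in a monomial of $P^{(1)}_i(x)$ with positive coefficient is strongly connected (a single vertex counts as strongly connected), and that it has an LFP $q_1^*$ with $0<q_1^*\le\mathbf 1$. Let $$\alpha=\min\{1,c_{\min}\}\cdot\min\{y_{\min},\tfrac12 q^*_{\min}\},$$ where $c_{\min}$ is the smallest non-zero coefficient (or constant term) of the polynomials $P_i(x,y)$,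 $y_{\min}$ is the smallest coordinate of $y^{(1)}$, and $q^*_{\min}$ is the smallest coordinate of $q_1^*$. Then: 1. The system $x=P^{(2)}(x)$ has an LFP $q_2^*$, it satisfies $0\le q_2^*\le q_1^*$, and $$\|q_1^*-q_2^*\|_\infty\le\sqrt{4n\,\alpha^{-(3n+1)}\,\|P(\mathbf 1,\mathbf 1)\|_\infty\,\|y^{(1)}-y^{(2)}\|_\infty}.$$ Furthermore, if all polynomials of $P^{(1)}(x)$ have degree at most $1$ in $x$, then $$\|q_1^*-q_2^*\|_\infty\le 2n\,\alpha^{-(n+2)}\,\|P(\mathbf 1,\mathbf 1)\|_\infty\,\|y^{(1)}-y^{(2)}\|_\infty.$$ 2. Let $B(z)$ be the Jacobian matrix of $P^{(2)}$ at $z$. For an integer $h>0$, the rounded-down Newton method with parameter $h$ on $x=P^{(2)}(x)$ starts at $x^{[0]}=\mathbf 0$ and, given $x^{[k]}$, lets $x^{[k+1]}_i$ be the largest multiple of $2^{-h}$ that is at most $\max\{N_i,0\}$, where $N=x^{[k]}+(I-B(x^{[k]}))^{-1}\bigl(P^{(2)}(x^{[k]})-x^{[k]}\bigr)$; this iteration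 is defined if $I-B(x^{[k]})$ is non-singular. For every $0<\epsilon<1$ and all integers $h\ge\lceil 2+n\log\frac1\alpha+\log\frac1\epsilon\rceil$ and $g\ge h-1$, the first $g$ iterations of this method are all defined, and $\|q_2^*-x^{[g]}\|_\infty\le\epsilon$. -/

import Mathlib

namespace MPS

noncomputable section

/-- All coefficients (including the constant terms) of a vector of polynomials are non-negative. -/
def IsMonotone {ι σ : Type*} (Q : ι → MvPolynomial σ ℝ) : Prop :=
  ∀ i d, 0 ≤ (Q i).coeff d

/-- Every polynomial of the vector has (total) degree at most `2`. -/
def IsQuadratic {ι σ : Type*} (Q : ι → MvPolynomial σ ℝ) : Prop :=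
  ∀ i, (Q i).totalDegree ≤ 2

/-- Every polynomial of the vector has (total) degree at most `1`. -/
def IsLinear {ι σ : Type*} (Q : ι → MvPolynomial σ ℝ) : Prop :=
  ∀ i, (Q i).totalDegree ≤ 1

/-- The value `Q(a)` of a vector of polynomials at the point `a`. -/
def evalVec {ι σ : Type*} (Q : ι → MvPolynomial σ ℝ) (a : σ → ℝ) : ι → ℝ :=
  fun i => MvPolynomial.eval a (Q i)

/-- The system `P(x, y)` with the real vector `y` plugged in, as a vector of polynomials in `x`. -/
def plug {n m : ℕ} (P : Fin n → MvPolynomial (Fin n ⊕ Fin m) ℝ) (y : Fin m → ℝ) :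
    Fin n → MvPolynomial (Fin n) ℝ :=
  fun i => MvPolynomial.aeval
    (Sum.elim (fun j => MvPolynomial.X j) (fun k => MvPolynomial.C (y k))) (P i)

/-- `q` is the least fixed point solution of `x = Q(x)` in the non-negative orthant. -/
def IsLFP {n : ℕ} (Q : Fin n → MvPolynomial (Fin n) ℝ) (q : Fin n → ℝ) : Prop :=
  IsLeast {a : Fin n → ℝ | 0 ≤ a ∧ a = evalVec Q a} q

/-- Edges of the dependency graph: `x_j` appears in some monomial of `Q_i(x)` that has a positive
coefficient. -/
def DependsOn {n : ℕ} (Q : Fin n → MvPolynomial (Fin n) ℝ) (i j : Fin n) : Prop :=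
  ∃ d : Fin n →₀ ℕ, 0 < (Q i).coeff d ∧ d j ≠ 0

/-- The dependency graph is strongly connected: there is a (possibly empty) directed path from
every variable to every variable. -/
def StronglyConnected {n : ℕ} (Q : Fin n → MvPolynomial (Fin n) ℝ) : Prop :=
  ∀ i j : Fin n, Relation.ReflTransGen (DependsOn Q) i j

/-- The smallest non-zero coefficient (or constant term) of the polynomials of the vector.
The set is finite, and non-empty as soon as some polynomial of the vector is non-zero. -/
def cMin {n : ℕ} {σ : Type*} (Q : Fin n → MvPolynomial σ ℝ) : ℝ :=
  sInf {c : ℝ | c ≠ 0 ∧ ∃ i d, (Q i).coeff d = c}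

/-- The minimum coordinate of a vector (of positive length). -/
def vMin {k : ℕ} (v : Fin k → ℝ) : ℝ := ⨅ i, v i

/-- `α = min {1, c_min} · min {y_min, q_min / 2}`. -/
def alpha {n m : ℕ} (P : Fin n → MvPolynomial (Fin n ⊕ Fin m) ℝ) (y : Fin m → ℝ)
    (q : Fin n → ℝ) : ℝ :=
  min 1 (cMin P) * min (vMin y) (1 / 2 * vMin q)

/-- The Jacobian matrix `B(z)` of `Q` at `z`. -/
def jacobian {n : ℕ} (Q : Fin n → MvPolynomial (Fin n) ℝ) (z : Fin n → ℝ) :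
    Matrix (Fin n) (Fin n) ℝ :=
  Matrix.of fun i j => MvPolynomial.eval z (MvPolynomial.pderiv j (Q i))

/-- The Newton iteration is defined at `z`: the matrix `I - B(z)` is non-singular. -/
def NewtonDefined {n : ℕ} (Q : Fin n → MvPolynomial (Fin n) ℝ) (z : Fin n → ℝ) : Prop :=
  IsUnit (1 - jacobian Q z)

/-- The Newton operator `N(z) = z + (I - B(z))⁻¹ (Q(z) - z)`
(meaningful where `NewtonDefined Q z` holds). -/
def newton {n : ℕ} (Q : Fin n → MvPolynomial (Fin n) ℝ) (z : Fin n → ℝ) : Fin n → ℝ :=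
  z + Matrix.mulVec (1 - jacobian Q z)⁻¹ (evalVec Q z - z)

/-- The largest multiple of `2⁻ʰ` that is at most `max t 0`. -/
def roundDown (h : ℕ) (t : ℝ) : ℝ := (⌊max t 0 * 2 ^ h⌋ : ℝ) / 2 ^ h

/-- The iterates of the rounded-down Newton method with rounding parameter `h`, started at `0`.
The step from iterate `k` to iterate `k + 1` is defined when `NewtonDefined` holds at iterate
`k`. -/
def rnm {n : ℕ} (Q : Fin n → MvPolynomial (Fin n) ℝ) (h : ℕ) : ℕ → Fin n → ℝ
  | 0 => 0
  | k + 1 => fun i => roundDown h (newton Q (rnm Q h k) i)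

end

end MPS

/-!
The functions `x ↦ P(x, y)` are treated as quadratic maps with non-negative coefficients
(`QuadMap`). Two exact identities replace estimates throughout: the mean value formula
`F(b) - F(a) = B((a + b) / 2) (b - a)`, and the fact that the linearization of `F` at `a` misses
`F(b)` by exactly the quadratic part evaluated at `b - a`. The system for `y₂` has the same
quadratic part as the one for `y₁` and smaller constant and linear coefficients
(`QuadMap.IsDominatedBy`).

*Cone vector.* The Jacobian `B(q₁)` of the larger system at its least fixed point has a vector
`d > 0` with `B(q₁) d ≤ d`. For affine systems `q₁` itself will do. Otherwise, the differences
`e_k = q₁ - x_k` of the Kleene iterates satisfy `B((x_k + q₁) / 2) e_k = e_{k+1} ≤ e_k`, and `d` is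
a limit point of `e_k / ‖e_k‖`; no spectral theory is needed. As the non-zero entries of `B` are at
least `α` at points above `q₁ / 2` and the dependency graph is strongly connected, the entries of
`d` differ at most by the factor `α ^ (n - 1)` (`QuadMap.IsIrreducibleSystem.exists_cone`).

*Monotonicity.* With a cone vector, irreducibility shows that `1 - B(x)` is invertible with a
non-negative inverse for the dominated system, provided that `x ≤ q₁` and, unless the larger system
is affine, `x < q₁` in all coordinates (`QuadMap.IsDominatedBy.isMonotoneMatrix_jac`).

*Perturbation.* The difference `δ = q₁ - q₂` solves `(1 - B) δ = c` with `B` the Jacobian of the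
larger system at the midpoint of `q₁` and `q₂`, and `0 ≤ c ≤ 2 ‖P(1, 1)‖ ‖y₁ - y₂‖`. The entries of
`(1 - B)⁻¹` are controlled by a vector `v ≤ 1` for which `(1 - B) v ≥ 0` has one coordinate that is
not too small (`IsMonotoneMatrix.solution_le`). In the affine case this is `v = q₁`, for which
`(1 - B) v` is the constant term. Otherwise it is `v = d`, for which `(1 - B) d` has a coordinate
proportional to `‖δ‖`, and the bound obtained is one for `‖δ‖²`.

*Newton's method.* A Newton step halves the distance to `q₂` measured in multiples of `d`
(`QuadMap.IsNewtonStep.sub_le_half`), and rounding adds at most `2⁻ʰ / α ^ (n - 1)`. The iterates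
never reach `q₁` in any coordinate unless the system is affine, because the coordinates where they
do would form a set that is closed in the dependency graph
(`QuadMap.IsNewtonStep.lt_of_quad_ne_zero`); so all steps are defined.
-/

namespace MPS

open Relation Filter Topology

/-! ### Irreducible non-negative matrices -/

theorem mulVec_eq_sum_mul {ι κ : Type*} [Fintype κ] (B : Matrix ι κ ℝ) (v : κ → ℝ)
    (i : ι) : B.mulVec v i = ∑ j, B i j * v j := rfl

theorem exists_edge_into {V : Type*} {r : V → V → Prop} {S : Set V} {i j : V}
    (h : ReflTransGen r i j) (hi : i ∉ S) (hj : j ∈ S) : ∃ a b, r a b ∧ a ∉ S ∧ b ∈ S := by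
  induction h using ReflTransGen.head_induction_on with
  | refl => exact absurd hj hi
  | @head a c hac _ ih =>
    by_cases hc : c ∈ S
    · exact ⟨a, c, hac, hi, hc⟩
    · exact ih hc

/-- On a strongly connected graph with `n` vertices, a function that loses at most a factor `α`
along every edge loses at most a factor `α ^ (n - 1)` altogether: the superlevel set of
`α ^ t * f j` gains a vertex whenever `t` grows by one, until it contains every vertex. -/
theorem pow_mul_le_of_edges {n : ℕ} {r : Fin n → Fin n → Prop}
    (hr : ∀ i j, ReflTransGen r i j) {α : ℝ} (hα0 : 0 ≤ α) (hα1 : α ≤ 1)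
    {f : Fin n → ℝ} (hf : 0 ≤ f) (hedge : ∀ i j, r i j → α * f j ≤ f i) (i j : Fin n) :
    α ^ (n - 1) * f j ≤ f i := by
  classical
  let S : ℕ → Finset (Fin n) := fun t => {k | α ^ t * f j ≤ f k}
  have hmem : ∀ t k, k ∈ S t ↔ α ^ t * f j ≤ f k := fun t k => by simp [S]
  have hstep : ∀ t, S t ⊆ S (t + 1) := by
    intro t k hk
    rw [hmem] at hk ⊢
    refine le_trans ?_ hk
    exact mul_le_mul_of_nonneg_right (pow_le_pow_of_le_one hα0 hα1 (Nat.le_succ t)) (hf j)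
  have hmain : ∀ t, j ∈ S t ∧ (S t = Finset.univ ∨ t + 1 ≤ (S t).card) := by
    intro t
    induction t with
    | zero =>
      have hj : j ∈ S 0 := by simp [hmem]
      exact ⟨hj, Or.inr (Finset.card_pos.mpr ⟨j, hj⟩)⟩
    | succ t ih =>
      refine ⟨hstep t ih.1, ?_⟩
      rcases ih.2 with h | h
      · left
        exact Finset.eq_univ_of_forall fun k => hstep t (h ▸ Finset.mem_univ k)
      · by_cases hu : S t = Finset.univ
        · left
          exact Finset.eq_univ_of_forall fun k => hstep t (hu ▸ Finset.mem_univ k)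
        · right
          obtain ⟨k, hk⟩ : ∃ k, k ∉ S t := by
            by_contra hcon
            push Not at hcon
            exact hu (Finset.eq_univ_of_forall hcon)
          obtain ⟨a, b, hab, ha, hb⟩ :=
            exists_edge_into (S := (S t : Set (Fin n))) (hr k j) (by simpa using hk)
              (by simpa using ih.1)
          have ha' : a ∈ S (t + 1) := by
            have hb' := (hmem t b).1 (by simpa using hb)
            rw [hmem]
            calc α ^ (t + 1) * f j = α * (α ^ t * f j) := by ring
              _ ≤ α * f b := mul_le_mul_of_nonneg_left hb' hα0
              _ ≤ f a := hedge a b hab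
          have hss : S t ⊂ S (t + 1) :=
            (Finset.ssubset_iff_of_subset (hstep t)).2 ⟨a, ha', by simpa using ha⟩
          have := Finset.card_lt_card hss
          omega
  have hn : 0 < n := Fin.pos j
  have huniv : S (n - 1) = Finset.univ := by
    rcases (hmain (n - 1)).2 with h | h
    · exact h
    · apply Finset.eq_univ_of_card
      have := Finset.card_le_univ (S (n - 1))
      rw [Fintype.card_fin] at this ⊢
      omega
  rw [← hmem, huniv]
  exact Finset.mem_univ i

/-- A criterion for `1 - B` to be monotone: `v` is a positive vector with `B v ≤ v`, and no
non-empty set of indices is closed under the edges of `B` while `B v = v` holds on it. -/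
theorem nonneg_of_mulVec_le {n : ℕ} {B : Matrix (Fin n) (Fin n) ℝ} (hB : ∀ i j, 0 ≤ B i j)
    {v : Fin n → ℝ} (hv : ∀ i, 0 < v i) (hBv : B.mulVec v ≤ v)
    (hZ : ∀ Z : Set (Fin n), Z.Nonempty → (∀ i ∈ Z, B.mulVec v i = v i) →
      (∀ i ∈ Z, ∀ j ∉ Z, B i j = 0) → False)
    {w : Fin n → ℝ} (hw : B.mulVec w ≤ w) : 0 ≤ w := by
  by_contra hneg
  obtain ⟨i₀, hi₀⟩ : ∃ i, w i < 0 := by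
    by_contra hcon
    push Not at hcon
    exact hneg hcon
  have : Nonempty (Fin n) := ⟨i₀⟩
  -- `t` is the least number for which `w + t v` is non-negative.
  obtain ⟨k, hk⟩ := Finite.exists_max fun i => -w i / v i
  set t := -w k / v k with ht
  have htpos : 0 < t := lt_of_lt_of_le (div_pos (neg_pos.2 hi₀) (hv i₀)) (hk i₀)
  set e : Fin n → ℝ := w + t • v with he
  have he0 : ∀ i, 0 ≤ e i := by
    intro i
    have := (div_le_iff₀ (hv i)).1 (hk i)
    simp only [he, Pi.add_apply, Pi.smul_apply, smul_eq_mul]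
    linarith
  have hek : e k = 0 := by
    simp only [he, Pi.add_apply, Pi.smul_apply, smul_eq_mul, ht]
    rw [div_mul_cancel₀ _ (hv k).ne']
    ring
  have hBe : ∀ i, B.mulVec e i = B.mulVec w i + t * B.mulVec v i := by
    intro i
    simp [he, Matrix.mulVec_add, Matrix.mulVec_smul]
  have hBe0 : ∀ i, 0 ≤ B.mulVec e i := fun i => by
    rw [mulVec_eq_sum_mul]
    exact Finset.sum_nonneg fun j _ => mul_nonneg (hB i j) (he0 j)
  have hei : ∀ i, e i = w i + t * v i := fun i => rfl
  refine hZ {i | e i = 0} ⟨k, hek⟩ ?_ ?_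
  · intro i hi
    have h0 : e i = 0 := hi
    have h1 := hw i
    have h2 := hBv i
    have h3 := hBe0 i
    rw [hBe] at h3
    rw [hei] at h0
    have h4 : t * v i ≤ t * B.mulVec v i := by linarith
    exact le_antisymm h2 (le_of_mul_le_mul_left h4 htpos)
  · intro i hi j hj
    have h0 : e i = 0 := hi
    have h1 := hw i
    have h2 := mul_le_mul_of_nonneg_left (hBv i) htpos.le
    have h3 : B.mulVec e i = 0 := by
      refine le_antisymm ?_ (hBe0 i)
      rw [hBe]
      rw [hei] at h0
      linarith
    rw [mulVec_eq_sum_mul] at h3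
    have h4 := (Finset.sum_eq_zero_iff_of_nonneg fun j _ => mul_nonneg (hB i j) (he0 j)).1 h3 j
      (Finset.mem_univ j)
    exact (mul_eq_zero.1 h4).resolve_right hj

/-- `1 - B` is monotone: a vector `w` with `(1 - B) w ≥ 0` is non-negative. -/
def IsMonotoneMatrix {n : ℕ} (B : Matrix (Fin n) (Fin n) ℝ) : Prop :=
  ∀ w : Fin n → ℝ, B.mulVec w ≤ w → 0 ≤ w

theorem IsMonotoneMatrix.isUnit {n : ℕ} {B : Matrix (Fin n) (Fin n) ℝ}
    (h : IsMonotoneMatrix B) : IsUnit (1 - B) := by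
  rw [← Matrix.mulVec_injective_iff_isUnit]
  intro a b hab
  have key : ∀ u v : Fin n → ℝ, (1 - B).mulVec u = (1 - B).mulVec v → v ≤ u := by
    intro u v huv
    rw [← sub_nonneg]
    apply h
    rw [Matrix.sub_mulVec, Matrix.sub_mulVec, Matrix.one_mulVec, Matrix.one_mulVec] at huv
    rw [Matrix.mulVec_sub]
    intro i
    have := congrFun huv i
    simp only [Pi.sub_apply] at this ⊢
    linarith
  exact le_antisymm (key b a hab.symm) (key a b hab)

theorem IsMonotoneMatrix.inv_nonneg {n : ℕ} {B : Matrix (Fin n) (Fin n) ℝ}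
    (h : IsMonotoneMatrix B) (i j : Fin n) : 0 ≤ (1 - B)⁻¹ i j := by
  have hdet : IsUnit (1 - B).det := (Matrix.isUnit_iff_isUnit_det _).1 h.isUnit
  have hw := h ((1 - B)⁻¹.mulVec (Pi.single j 1)) (by
    have h1 : (1 - B).mulVec ((1 - B)⁻¹.mulVec (Pi.single j 1)) = Pi.single j 1 := by
      rw [Matrix.mulVec_mulVec, Matrix.mul_nonsing_inv _ hdet, Matrix.one_mulVec]
    rw [Matrix.sub_mulVec, Matrix.one_mulVec] at h1
    rw [← sub_nonneg, h1]
    exact Pi.single_nonneg.2 zero_le_one) i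
  simpa using hw

/-- A bound for the solution of `(1 - B) δ = c` when `B` is irreducible with entries at least `α`
along the edges of `r`. The entries of a row of `(1 - B)⁻¹` differ by a factor of at most
`α ^ (n - 1)`, and a vector `v ≤ 1` with `(1 - B) v ≥ 0` that is at least `η` at the index `k`
bounds the entry at `k` by `η⁻¹`. -/
theorem IsMonotoneMatrix.solution_le {n : ℕ} {B : Matrix (Fin n) (Fin n) ℝ}
    (h : IsMonotoneMatrix B) (hB : ∀ i j, 0 ≤ B i j) {r : Fin n → Fin n → Prop}
    (hr : ∀ i j, ReflTransGen r i j) {α : ℝ} (hα0 : 0 ≤ α) (hα1 : α ≤ 1)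
    (hedge : ∀ i j, r i j → α ≤ B i j) {v : Fin n → ℝ} (hBv : B.mulVec v ≤ v)
    (hv1 : ∀ i, v i ≤ 1) {k : Fin n} {η : ℝ} (hη : 0 ≤ η) (hk : η ≤ v k - B.mulVec v k)
    {δ : Fin n → ℝ} {C : ℝ} (hC : 0 ≤ C) (hδ : ∀ i, δ i - B.mulVec δ i ≤ C) (i : Fin n) :
    δ i * (α ^ (n - 1) * η) ≤ n * C := by
  have hdet : IsUnit (1 - B).det := (Matrix.isUnit_iff_isUnit_det _).1 h.isUnit
  set g : Fin n → ℝ := fun j => (1 - B)⁻¹ i j with hg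
  have hg0 : 0 ≤ g := fun j => h.inv_nonneg i j
  have hsolve : ∀ u : Fin n → ℝ, u i = ∑ j, g j * (u j - B.mulVec u j) := by
    intro u
    have h1 : (1 - B)⁻¹.mulVec ((1 - B).mulVec u) = u := by
      rw [Matrix.mulVec_mulVec, Matrix.nonsing_inv_mul _ hdet, Matrix.one_mulVec]
    have h2 := congrFun h1 i
    rw [Matrix.sub_mulVec, Matrix.one_mulVec] at h2
    exact h2.symm
  have hgB : ∀ a b, g a * B a b ≤ g b := by
    intro a b
    have h1 : (1 - B)⁻¹ = 1 + (1 - B)⁻¹ * B := by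
      have := Matrix.nonsing_inv_mul _ hdet
      rw [mul_sub, mul_one] at this
      exact sub_eq_iff_eq_add.1 this
    have h2 : g b = (1 : Matrix (Fin n) (Fin n) ℝ) i b + ∑ j, g j * B j b := by
      have := congrFun (congrFun h1 i) b
      rwa [Matrix.add_apply, Matrix.mul_apply] at this
    have h3 : g a * B a b ≤ ∑ j, g j * B j b :=
      Finset.single_le_sum (f := fun j => g j * B j b)
        (fun j _ => mul_nonneg (hg0 j) (hB j b)) (Finset.mem_univ a)
    have h4 : 0 ≤ (1 : Matrix (Fin n) (Fin n) ℝ) i b := by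
      rw [Matrix.one_apply]
      split_ifs <;> norm_num
    linarith
  have hgk : g k * η ≤ 1 := by
    calc g k * η ≤ g k * (v k - B.mulVec v k) := mul_le_mul_of_nonneg_left hk (hg0 k)
      _ ≤ ∑ j, g j * (v j - B.mulVec v j) :=
        Finset.single_le_sum (f := fun j => g j * (v j - B.mulVec v j))
          (fun j _ => mul_nonneg (hg0 j) (sub_nonneg.2 (hBv j))) (Finset.mem_univ k)
      _ = v i := (hsolve v).symm
      _ ≤ 1 := hv1 i
  have hgj : ∀ j, g j * (α ^ (n - 1) * η) ≤ 1 := by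
    intro j
    have h1 : α ^ (n - 1) * g j ≤ g k := by
      refine pow_mul_le_of_edges (r := Function.swap r) (fun a b => ?_) hα0 hα1 hg0
        (fun a b hab => ?_) k j
      · exact reflTransGen_swap.2 (hr b a)
      · calc α * g b = g b * α := mul_comm _ _
          _ ≤ g b * B b a := mul_le_mul_of_nonneg_left (hedge b a hab) (hg0 b)
          _ ≤ g a := hgB b a
    calc g j * (α ^ (n - 1) * η) = α ^ (n - 1) * g j * η := by ring
      _ ≤ g k * η := mul_le_mul_of_nonneg_right h1 hη
      _ ≤ 1 := hgk
  calc δ i * (α ^ (n - 1) * η)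
      = ∑ j, g j * (δ j - B.mulVec δ j) * (α ^ (n - 1) * η) := by
        rw [hsolve δ, Finset.sum_mul]
    _ ≤ ∑ _j : Fin n, C := by
        refine Finset.sum_le_sum fun j _ => ?_
        have h0 : 0 ≤ g j * (α ^ (n - 1) * η) := mul_nonneg (hg0 j) (by positivity)
        calc g j * (δ j - B.mulVec δ j) * (α ^ (n - 1) * η)
            = (δ j - B.mulVec δ j) * (g j * (α ^ (n - 1) * η)) := by ring
          _ ≤ C * (g j * (α ^ (n - 1) * η)) := mul_le_mul_of_nonneg_right (hδ j) h0
          _ ≤ C * 1 := mul_le_mul_of_nonneg_left (hgj j) hC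
          _ = C := mul_one C
    _ = n * C := by simp

/-! ### Quadratic maps with non-negative coefficients -/

/-- A vector of polynomials of degree at most two with non-negative coefficients, given by its
constant terms, its linear coefficients and, for each component, a symmetric matrix of quadratic
coefficients. Thus `quad i j k` with `j ≠ k` is half the coefficient of `x_j x_k`. -/
structure QuadMap (ι σ : Type*) where
  /-- the constant terms -/
  const : ι → ℝ
  /-- the coefficients of the linear terms -/
  lin : ι → σ → ℝ
  /-- the symmetric matrices of the quadratic terms -/
  quad : ι → σ → σ → ℝ
  const_nonneg : ∀ i, 0 ≤ const i
  lin_nonneg : ∀ i j, 0 ≤ lin i j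
  quad_nonneg : ∀ i j k, 0 ≤ quad i j k
  quad_symm : ∀ i j k, quad i j k = quad i k j

namespace QuadMap

/-- The symmetric bilinear form of the quadratic part of the `i`-th component. -/
def form {ι σ : Type*} [Fintype σ] (F : QuadMap ι σ) (i : ι) (u v : σ → ℝ) : ℝ :=
  ∑ j, ∑ k, F.quad i j k * (u j * v k)

/-- The value at `x`. -/
def eval {ι σ : Type*} [Fintype σ] (F : QuadMap ι σ) (x : σ → ℝ) : ι → ℝ :=
  fun i => F.const i + ∑ j, F.lin i j * x j + F.form i x x

/-- The Jacobian matrix at `x`. -/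
def jac {ι σ : Type*} [Fintype σ] (F : QuadMap ι σ) (x : σ → ℝ) : Matrix ι σ ℝ :=
  Matrix.of fun i j => F.lin i j + 2 * ∑ k, F.quad i j k * x k

section Basic

variable {ι σ : Type*} [Fintype σ] (F : QuadMap ι σ)

theorem form_comm (i : ι) (u v : σ → ℝ) : F.form i u v = F.form i v u := by
  unfold form
  rw [Finset.sum_comm]
  refine Finset.sum_congr rfl fun j _ => Finset.sum_congr rfl fun k _ => ?_
  rw [F.quad_symm i k j, mul_comm (u k)]

theorem form_add_right (i : ι) (u v w : σ → ℝ) :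
    F.form i u (v + w) = F.form i u v + F.form i u w := by
  simp only [form, ← Finset.sum_add_distrib, Pi.add_apply, mul_add]

theorem form_smul_right (i : ι) (u : σ → ℝ) (t : ℝ) (v : σ → ℝ) :
    F.form i u (t • v) = t * F.form i u v := by
  simp only [form, Finset.mul_sum, Pi.smul_apply, smul_eq_mul]
  refine Finset.sum_congr rfl fun j _ => Finset.sum_congr rfl fun k _ => ?_
  ring

theorem form_sub_right (i : ι) (u v w : σ → ℝ) :
    F.form i u (v - w) = F.form i u v - F.form i u w := by
  simp only [form, ← Finset.sum_sub_distrib, Pi.sub_apply, mul_sub]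

theorem form_sub_left (i : ι) (u v w : σ → ℝ) :
    F.form i (u - v) w = F.form i u w - F.form i v w := by
  rw [form_comm, form_sub_right, form_comm, F.form_comm i w v]

theorem form_nonneg (i : ι) {u v : σ → ℝ} (hu : 0 ≤ u) (hv : 0 ≤ v) : 0 ≤ F.form i u v :=
  Finset.sum_nonneg fun j _ => Finset.sum_nonneg fun k _ =>
    mul_nonneg (F.quad_nonneg i j k) (mul_nonneg (hu j) (hv k))

theorem form_le_form_right (i : ι) {u v w : σ → ℝ} (hu : 0 ≤ u) (hvw : v ≤ w) :
    F.form i u v ≤ F.form i u w := by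
  rw [← sub_nonneg, ← form_sub_right]
  exact F.form_nonneg i hu (sub_nonneg.2 hvw)

theorem quad_mul_le_form (i : ι) {u v : σ → ℝ} (hu : 0 ≤ u) (hv : 0 ≤ v) (j k : σ) :
    F.quad i j k * (u j * v k) ≤ F.form i u v := by
  have h : ∀ a b, 0 ≤ F.quad i a b * (u a * v b) := fun a b =>
    mul_nonneg (F.quad_nonneg i a b) (mul_nonneg (hu a) (hv b))
  calc F.quad i j k * (u j * v k) ≤ ∑ b, F.quad i j b * (u j * v b) :=
        Finset.single_le_sum (f := fun b => F.quad i j b * (u j * v b)) (fun b _ => h j b)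
          (Finset.mem_univ k)
    _ ≤ F.form i u v :=
        Finset.single_le_sum (f := fun a => ∑ b, F.quad i a b * (u a * v b))
          (fun a _ => Finset.sum_nonneg fun b _ => h a b) (Finset.mem_univ j)

theorem jac_apply (x : σ → ℝ) (i : ι) (j : σ) :
    F.jac x i j = F.lin i j + 2 * ∑ k, F.quad i j k * x k := rfl

theorem jac_mulVec (x v : σ → ℝ) (i : ι) :
    (F.jac x).mulVec v i = ∑ j, F.lin i j * v j + 2 * F.form i v x := by
  simp only [mulVec_eq_sum_mul, jac_apply, add_mul, Finset.sum_add_distrib, form, Finset.mul_sum,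
    Finset.sum_mul]
  congr 1
  refine Finset.sum_congr rfl fun j _ => Finset.sum_congr rfl fun k _ => ?_
  ring

theorem jac_nonneg {x : σ → ℝ} (hx : 0 ≤ x) (i : ι) (j : σ) : 0 ≤ F.jac x i j :=
  add_nonneg (F.lin_nonneg i j) (mul_nonneg zero_le_two
    (Finset.sum_nonneg fun k _ => mul_nonneg (F.quad_nonneg i j k) (hx k)))

theorem lin_le_jac {x : σ → ℝ} (hx : 0 ≤ x) (i : ι) (j : σ) : F.lin i j ≤ F.jac x i j :=
  le_add_of_nonneg_right (mul_nonneg zero_le_two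
    (Finset.sum_nonneg fun k _ => mul_nonneg (F.quad_nonneg i j k) (hx k)))

theorem quad_le_jac {x : σ → ℝ} (hx : 0 ≤ x) (i : ι) (j k : σ) :
    2 * (F.quad i j k * x k) ≤ F.jac x i j := by
  have h : F.quad i j k * x k ≤ ∑ l, F.quad i j l * x l :=
    Finset.single_le_sum (f := fun l => F.quad i j l * x l)
      (fun l _ => mul_nonneg (F.quad_nonneg i j l) (hx l)) (Finset.mem_univ k)
  have := F.lin_nonneg i j
  rw [jac_apply]
  linarith

theorem jac_mulVec_sub (x z v : σ → ℝ) (i : ι) :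
    (F.jac z).mulVec v i - (F.jac x).mulVec v i = 2 * F.form i v (z - x) := by
  rw [jac_mulVec, jac_mulVec, form_sub_right]
  ring

theorem eval_sub_eval (a b : σ → ℝ) (i : ι) :
    F.eval b i - F.eval a i = ∑ j, F.lin i j * (b j - a j) + F.form i (b - a) (a + b) := by
  simp only [eval, mul_sub, Finset.sum_sub_distrib, form_sub_left, form_add_right]
  rw [F.form_comm i b a]
  ring

/-- The mean value formula for quadratic maps. -/
theorem eval_sub_eval_eq_mulVec (a b : σ → ℝ) (i : ι) :
    F.eval b i - F.eval a i = (F.jac ((1 / 2 : ℝ) • (a + b))).mulVec (b - a) i := by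
  rw [eval_sub_eval, jac_mulVec, form_smul_right]
  simp only [Pi.sub_apply]
  ring

theorem eval_sub_linearization (a b : σ → ℝ) (i : ι) :
    F.eval b i - F.eval a i - (F.jac a).mulVec (b - a) i = F.form i (b - a) (b - a) := by
  rw [eval_sub_eval, jac_mulVec]
  simp only [form_sub_left, form_add_right, form_sub_right, Pi.sub_apply]
  rw [F.form_comm i b a]
  ring

theorem eval_nonneg {x : σ → ℝ} (hx : 0 ≤ x) : 0 ≤ F.eval x := fun i =>
  add_nonneg (add_nonneg (F.const_nonneg i)
    (Finset.sum_nonneg fun j _ => mul_nonneg (F.lin_nonneg i j) (hx j))) (F.form_nonneg i hx hx)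

theorem eval_mono {a b : σ → ℝ} (ha : 0 ≤ a) (hab : a ≤ b) : F.eval a ≤ F.eval b := by
  intro i
  rw [← sub_nonneg, eval_sub_eval]
  exact add_nonneg
    (Finset.sum_nonneg fun j _ => mul_nonneg (F.lin_nonneg i j) (sub_nonneg.2 (hab j)))
    (F.form_nonneg i (sub_nonneg.2 hab) (add_nonneg ha (ha.trans hab)))

theorem jac_mono {a b : σ → ℝ} (hab : a ≤ b) (i : ι) (j : σ) : F.jac a i j ≤ F.jac b i j := by
  rw [jac_apply, jac_apply]
  gcongr with k
  · exact F.quad_nonneg i j k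
  · exact hab k

theorem continuous_form (i : ι) :
    Continuous fun p : (σ → ℝ) × (σ → ℝ) => F.form i p.1 p.2 := by
  unfold form
  fun_prop

theorem continuous_eval : Continuous F.eval := by
  unfold eval form
  fun_prop

/-- On points with coordinates at most `1` a quadratic map is Lipschitz, with twice its value at
the all-one vector as the constant. -/
theorem eval_sub_eval_le {a b : σ → ℝ} (ha : 0 ≤ a) (hab : a ≤ b) (hb : ∀ j, b j ≤ 1) {D : ℝ}
    (hD : ∀ j, b j - a j ≤ D) (hD0 : 0 ≤ D) (i : ι) :
    F.eval b i - F.eval a i ≤ 2 * F.eval (fun _ => 1) i * D := by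
  have h1 : ∑ j, F.lin i j * (b j - a j) ≤ (∑ j, F.lin i j * 1) * D := by
    rw [Finset.sum_mul]
    refine Finset.sum_le_sum fun j _ => ?_
    rw [mul_one]
    exact mul_le_mul_of_nonneg_left (hD j) (F.lin_nonneg i j)
  have h2 : F.form i (b - a) (a + b) ≤ F.form i (fun _ => 1) (fun _ => 1) * (2 * D) := by
    unfold form
    rw [Finset.sum_mul]
    refine Finset.sum_le_sum fun j _ => ?_
    rw [Finset.sum_mul]
    refine Finset.sum_le_sum fun k _ => ?_
    rw [mul_one, mul_one]
    refine mul_le_mul_of_nonneg_left ?_ (F.quad_nonneg i j k)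
    have hk : a k + b k ≤ 2 := by linarith [hb k, hab k]
    have hk0 : 0 ≤ a k + b k := add_nonneg (ha k) ((ha k).trans (hab k))
    calc (b j - a j) * (a k + b k) ≤ D * 2 := mul_le_mul (hD j) hk hk0 hD0
      _ = 2 * D := by ring
  have h3 : 0 ≤ (∑ j, F.lin i j * 1) * D :=
    mul_nonneg (Finset.sum_nonneg fun j _ => by simpa using F.lin_nonneg i j) hD0
  have h4 : 0 ≤ F.const i * D := mul_nonneg (F.const_nonneg i) hD0
  rw [eval_sub_eval]
  simp only [eval]
  linarith

end Basic

/-! ### Least fixed points -/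

/-- `q` is the least non-negative fixed point. -/
def IsLeastFixedPoint {n : ℕ} (F : QuadMap (Fin n) (Fin n)) (q : Fin n → ℝ) : Prop :=
  IsLeast {a : Fin n → ℝ | 0 ≤ a ∧ a = F.eval a} q

theorem exists_isLeastFixedPoint {n : ℕ} (F : QuadMap (Fin n) (Fin n)) {b : Fin n → ℝ}
    (hb : 0 ≤ b) (hFb : F.eval b ≤ b) : ∃ q, F.IsLeastFixedPoint q ∧ q ≤ b := by
  -- The infimum of the pre-fixed points, as in the Knaster–Tarski theorem.
  let S : Set (Fin n → ℝ) := {a | 0 ≤ a ∧ F.eval a ≤ a}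
  let q : Fin n → ℝ := fun i => sInf ((fun a : Fin n → ℝ => a i) '' S)
  have hbS : b ∈ S := ⟨hb, hFb⟩
  have hbdd : ∀ i, BddBelow ((fun a : Fin n → ℝ => a i) '' S) := fun i =>
    ⟨0, by rintro _ ⟨a, ha, rfl⟩; exact ha.1 i⟩
  have hqle : ∀ a ∈ S, q ≤ a := fun a ha i => csInf_le (hbdd i) ⟨a, ha, rfl⟩
  have hleq : ∀ c : Fin n → ℝ, (∀ a ∈ S, c ≤ a) → c ≤ q := fun c hc i =>
    le_csInf ⟨_, b, hbS, rfl⟩ (by rintro _ ⟨a, ha, rfl⟩; exact hc a ha i)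
  have hq0 : 0 ≤ q := hleq 0 fun a ha => ha.1
  have hFq : F.eval q ≤ q := hleq _ fun a ha => (F.eval_mono hq0 (hqle a ha)).trans ha.2
  have hqF : q ≤ F.eval q := hqle _ ⟨F.eval_nonneg hq0, F.eval_mono (F.eval_nonneg hq0) hFq⟩
  exact ⟨q, ⟨⟨hq0, le_antisymm hqF hFq⟩, fun a ha => hqle a ⟨ha.1, ha.2.symm.le⟩⟩, hqle b hbS⟩

theorem IsLeastFixedPoint.tendsto_iterate {n : ℕ} {F : QuadMap (Fin n) (Fin n)} {q : Fin n → ℝ}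
    (hq : F.IsLeastFixedPoint q) : Tendsto (fun k => F.eval^[k] 0) atTop (𝓝 q) := by
  have hb : ∀ k, 0 ≤ F.eval^[k] 0 ∧ F.eval^[k] 0 ≤ q ∧ F.eval^[k] 0 ≤ F.eval^[k + 1] 0 := by
    intro k
    induction k with
    | zero => exact ⟨le_rfl, hq.1.1, F.eval_nonneg le_rfl⟩
    | succ k ih =>
      simp only [Function.iterate_succ_apply'] at ih ⊢
      refine ⟨F.eval_nonneg ih.1, ?_, F.eval_mono ih.1 ih.2.2⟩
      rw [hq.1.2]
      exact F.eval_mono ih.1 ih.2.1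
  have hmono : Monotone fun k => F.eval^[k] 0 := monotone_nat_of_le_succ fun k => (hb k).2.2
  let L : Fin n → ℝ := fun i => ⨆ k, F.eval^[k] 0 i
  have hL : Tendsto (fun k => F.eval^[k] 0) atTop (𝓝 L) := by
    rw [tendsto_pi_nhds]
    intro i
    exact tendsto_atTop_ciSup (fun a b hab => hmono hab i)
      ⟨q i, by rintro _ ⟨k, rfl⟩; exact (hb k).2.1 i⟩
  have hfix : F.eval L = L := isFixedPt_of_tendsto_iterate hL F.continuous_eval.continuousAt
  have hL0 : 0 ≤ L := ge_of_tendsto' hL fun k => (hb k).1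
  have hLq : L ≤ q := le_of_tendsto' hL fun k => (hb k).2.1
  rwa [le_antisymm hLq (hq.2 ⟨hL0, hfix.symm⟩)] at hL

end QuadMap

namespace QuadMap

/-! ### Cone vectors of irreducible systems -/

/-- `x = F(x)` is a strongly connected system with least fixed point `q`, `0 < q ≤ 1`, such that
the Jacobian entries that belong to edges of the dependency graph are at least `α` at all points
above `q / 2`. -/
structure IsIrreducibleSystem {n : ℕ} (F : QuadMap (Fin n) (Fin n)) (q : Fin n → ℝ) (α : ℝ) :
    Prop where
  pos : ∀ i, 0 < q i
  le_one : ∀ i, q i ≤ 1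
  isLeast : F.IsLeastFixedPoint q
  connected : ∀ i j, ReflTransGen (fun i j => F.jac q i j ≠ 0) i j
  edge : ∀ i j, F.jac q i j ≠ 0 → ∀ z : Fin n → ℝ, (∀ k, q k / 2 ≤ z k) → α ≤ F.jac z i j
  alpha_pos : 0 < α
  alpha_le_half : α ≤ 1 / 2

namespace IsIrreducibleSystem

variable {n : ℕ} {F : QuadMap (Fin n) (Fin n)} {q : Fin n → ℝ} {α : ℝ}

theorem nonneg (h : F.IsIrreducibleSystem q α) : 0 ≤ q := fun i => (h.pos i).le

theorem alpha_le_one (h : F.IsIrreducibleSystem q α) : α ≤ 1 :=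
  h.alpha_le_half.trans (by norm_num)

theorem eval_eq (h : F.IsIrreducibleSystem q α) : F.eval q = q := h.isLeast.1.2.symm

/-- A non-negative vector `e` with `B(z) e ≤ e` has entries within a factor `α ^ (n - 1)` of each
other. -/
theorem pow_mul_le (h : F.IsIrreducibleSystem q α) {z e : Fin n → ℝ} (hz : ∀ k, q k / 2 ≤ z k)
    (he : 0 ≤ e) (hBe : (F.jac z).mulVec e ≤ e) (i j : Fin n) : α ^ (n - 1) * e j ≤ e i := by
  have hz0 : 0 ≤ z := fun k => (half_pos (h.pos k)).le.trans (hz k)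
  refine pow_mul_le_of_edges h.connected h.alpha_pos.le h.alpha_le_one he (fun a b hab => ?_) i j
  refine le_trans ?_ (hBe a)
  rw [mulVec_eq_sum_mul]
  exact (mul_le_mul_of_nonneg_right (h.edge a b hab z hz) (he b)).trans
    (Finset.single_le_sum (f := fun c => F.jac z a c * e c)
      (fun c _ => mul_nonneg (F.jac_nonneg hz0 a c) (he c)) (Finset.mem_univ b))

theorem exists_const_ne_zero (h : F.IsIrreducibleSystem q α) (i₀ : Fin n) :
    ∃ i, F.const i ≠ 0 := by
  by_contra hcon
  push Not at hcon
  have h0 : F.eval 0 = 0 := by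
    funext i
    simp [eval, form, hcon i]
  have := h.isLeast.2 ⟨le_rfl, h0.symm⟩ i₀
  exact absurd (h.pos i₀) (not_lt.2 this)

theorem exists_jac_ne_zero (h : F.IsIrreducibleSystem q α) {a b c : Fin n}
    (hquad : F.quad a b c ≠ 0) (i : Fin n) : ∃ j, F.jac q i j ≠ 0 := by
  rcases (h.connected i a).cases_head with rfl | ⟨j, hj, -⟩
  · refine ⟨b, ne_of_gt (lt_of_lt_of_le ?_ (F.quad_le_jac h.nonneg i b c))⟩
    have := (F.quad_nonneg i b c).lt_of_ne' hquad
    have := h.pos c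
    positivity
  · exact ⟨j, hj⟩

theorem iterate_bounds (h : F.IsIrreducibleSystem q α) {a b c : Fin n}
    (hquad : F.quad a b c ≠ 0) (k : ℕ) :
    0 ≤ F.eval^[k] 0 ∧ F.eval^[k] 0 ≤ F.eval^[k + 1] 0 ∧ ∀ i, F.eval^[k] 0 i < q i := by
  induction k with
  | zero => exact ⟨le_rfl, F.eval_nonneg le_rfl, h.pos⟩
  | succ k ih =>
    simp only [Function.iterate_succ_apply'] at ih ⊢
    obtain ⟨h0, h1, h2⟩ := ih
    set x := F.eval^[k] 0
    refine ⟨F.eval_nonneg h0, F.eval_mono h0 h1, fun i => ?_⟩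
    obtain ⟨j, hj⟩ := h.exists_jac_ne_zero hquad i
    have hm : ∀ l, q l / 2 ≤ ((1 / 2 : ℝ) • (x + q)) l := fun l => by
      have : 0 ≤ x l := h0 l
      simp only [Pi.smul_apply, Pi.add_apply, smul_eq_mul]
      linarith
    have hm0 : 0 ≤ (1 / 2 : ℝ) • (x + q) := fun l => (half_pos (h.pos l)).le.trans (hm l)
    have hpos : 0 < (F.jac ((1 / 2 : ℝ) • (x + q))).mulVec (q - x) i := by
      rw [mulVec_eq_sum_mul]
      refine Finset.sum_pos' (fun l _ => mul_nonneg (F.jac_nonneg hm0 i l)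
        (sub_nonneg.2 (h2 l).le)) ⟨j, Finset.mem_univ j, mul_pos ?_ (sub_pos.2 (h2 j))⟩
      exact h.alpha_pos.trans_le (h.edge i j hj _ hm)
    rw [← eval_sub_eval_eq_mulVec, h.eval_eq] at hpos
    exact sub_pos.1 hpos

/-- If the quadratic part is non-zero, the differences `q - F^k(0)` shrink along the Kleene
iteration without vanishing, so that a limit point of their directions is a cone vector. -/
theorem exists_cone_of_quad_ne_zero (h : F.IsIrreducibleSystem q α) {a b c : Fin n}
    (hquad : F.quad a b c ≠ 0) :
    ∃ d : Fin n → ℝ, 0 ≤ d ∧ ‖d‖ = 1 ∧ (F.jac q).mulVec d ≤ d := by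
  set x : ℕ → Fin n → ℝ := fun k => F.eval^[k] 0 with hx
  have hxb := h.iterate_bounds hquad
  have hxlim : Tendsto x atTop (𝓝 q) := h.isLeast.tendsto_iterate
  have he0 : ∀ k, 0 ≤ q - x k := fun k => sub_nonneg.2 fun i => ((hxb k).2.2 i).le
  have hene : ∀ k, ‖q - x k‖ ≠ 0 := fun k hk => by
    have := congrFun (norm_eq_zero.1 hk) a
    exact (sub_pos.2 ((hxb k).2.2 a)).ne' this
  set d : ℕ → Fin n → ℝ := fun k => ‖q - x k‖⁻¹ • (q - x k) with hd
  have hdmem : ∀ k, d k ∈ Metric.sphere (0 : Fin n → ℝ) 1 := fun k => by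
    rw [mem_sphere_zero_iff_norm, hd, norm_smul, norm_inv, norm_norm, inv_mul_cancel₀ (hene k)]
  have hd0 : ∀ k, 0 ≤ d k := fun k => smul_nonneg (inv_nonneg.2 (norm_nonneg _)) (he0 k)
  have hBd : ∀ k, (F.jac ((1 / 2 : ℝ) • (x k + q))).mulVec (d k) ≤ d k := fun k i => by
    rw [hd, Matrix.mulVec_smul]
    refine smul_le_smul_of_nonneg_left (β := ℝ) ?_ (inv_nonneg.2 (norm_nonneg _))
    rw [← eval_sub_eval_eq_mulVec, h.eval_eq]
    have : x k i ≤ F.eval (x k) i := by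
      have := (hxb k).2.1 i
      rwa [Function.iterate_succ_apply'] at this
    simp only [Pi.sub_apply]
    linarith
  obtain ⟨D, hD, φ, hφ, hlim⟩ := (isCompact_sphere (0 : Fin n → ℝ) 1).tendsto_subseq hdmem
  have hmlim : Tendsto (fun k => (1 / 2 : ℝ) • (x (φ k) + q)) atTop (𝓝 q) := by
    have h1 : Tendsto (fun k => (1 / 2 : ℝ) • (x (φ k) + q)) atTop (𝓝 ((1 / 2 : ℝ) • (q + q))) :=
      ((hxlim.comp hφ.tendsto_atTop).add_const q).const_smul _
    have h2 : (1 / 2 : ℝ) • (q + q) = q := by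
      funext i
      simp only [Pi.smul_apply, Pi.add_apply, smul_eq_mul]
      ring
    rwa [h2] at h1
  refine ⟨D, ge_of_tendsto' hlim fun k => hd0 _, mem_sphere_zero_iff_norm.1 hD, fun i => ?_⟩
  have hcont : Continuous fun p : (Fin n → ℝ) × (Fin n → ℝ) => (F.jac p.1).mulVec p.2 i := by
    simp only [jac_mulVec]
    have := (F.continuous_form i).comp continuous_swap
    exact (continuous_finsetSum _ fun j _ => by fun_prop).add (continuous_const.mul this)
  exact le_of_tendsto_of_tendsto' ((hcont.tendsto (q, D)).comp (hmlim.prodMk_nhds hlim))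
    ((continuous_apply i).tendsto D |>.comp hlim) fun k => hBd (φ k) i

theorem mulVec_jac_of_quad_eq_zero (hquad : F.quad = 0) (z v : Fin n → ℝ) (i : Fin n) :
    (F.jac z).mulVec v i = ∑ j, F.lin i j * v j := by
  rw [jac_mulVec]
  simp [form, hquad]

theorem jac_mulVec_self_of_quad_eq_zero (h : F.IsIrreducibleSystem q α) (hquad : F.quad = 0)
    (z : Fin n → ℝ) (i : Fin n) : (F.jac z).mulVec q i = q i - F.const i := by
  have h1 := congrFun h.eval_eq i
  rw [mulVec_jac_of_quad_eq_zero hquad]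
  simp only [eval, form, hquad, Pi.zero_apply, zero_mul, Finset.sum_const_zero] at h1
  linarith

/-- An irreducible system has a cone vector `d`, that is `B(q) d ≤ d`, with all entries between
`α ^ (n - 1)` and `1`. If the system is affine, `d` can be chosen such that the inequality is
strict in some coordinate. -/
theorem exists_cone (h : F.IsIrreducibleSystem q α) (i₀ : Fin n) :
    ∃ d : Fin n → ℝ, (∀ i, α ^ (n - 1) ≤ d i) ∧ (∀ i, d i ≤ 1) ∧ (F.jac q).mulVec d ≤ d ∧
      (F.quad = 0 → ∃ i, (F.jac q).mulVec d i < d i) := by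
  have hne : Nonempty (Fin n) := ⟨i₀⟩
  have key : ∃ d : Fin n → ℝ, 0 ≤ d ∧ ‖d‖ = 1 ∧ (F.jac q).mulVec d ≤ d ∧
      (F.quad = 0 → ∃ i, (F.jac q).mulVec d i < d i) := by
    by_cases hquad : F.quad = 0
    · have hnorm : 0 < ‖q‖ := norm_pos_iff.2 fun h0 => (h.pos i₀).ne' (congrFun h0 i₀)
      have hBq := h.jac_mulVec_self_of_quad_eq_zero hquad q
      refine ⟨‖q‖⁻¹ • q, smul_nonneg (inv_nonneg.2 hnorm.le) h.nonneg, ?_, fun i => ?_,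
        fun _ => ?_⟩
      · rw [norm_smul, norm_inv, norm_norm, inv_mul_cancel₀ hnorm.ne']
      · rw [Matrix.mulVec_smul]
        refine smul_le_smul_of_nonneg_left (β := ℝ) ?_ (inv_nonneg.2 hnorm.le)
        rw [hBq]
        linarith [F.const_nonneg i]
      · obtain ⟨i, hi⟩ := h.exists_const_ne_zero i₀
        refine ⟨i, ?_⟩
        rw [Matrix.mulVec_smul]
        refine mul_lt_mul_of_pos_left ?_ (inv_pos.2 hnorm)
        rw [hBq]
        linarith [(F.const_nonneg i).lt_of_ne' hi]
    · obtain ⟨a, b, c, habc⟩ : ∃ a b c, F.quad a b c ≠ 0 := by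
        by_contra hcon
        push Not at hcon
        exact hquad (funext fun a => funext fun b => funext fun c => hcon a b c)
      obtain ⟨d, h0, h1, h2⟩ := h.exists_cone_of_quad_ne_zero habc
      exact ⟨d, h0, h1, h2, fun h3 => absurd h3 hquad⟩
  obtain ⟨d, hd0, hd1, hBd, hstrict⟩ := key
  have hle : ∀ i, d i ≤ 1 := fun i => by
    rw [← hd1]
    exact (le_abs_self _).trans (norm_le_pi_norm d i)
  obtain ⟨j, hj⟩ : ∃ j, 1 ≤ d j := by
    by_contra hcon
    push Not at hcon
    refine lt_irrefl (1 : ℝ) ?_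
    nth_rewrite 1 [← hd1]
    refine (pi_norm_lt_iff zero_lt_one).2 fun i => ?_
    rw [Real.norm_of_nonneg (hd0 i)]
    exact hcon i
  refine ⟨d, fun i => ?_, hle, hBd, hstrict⟩
  calc α ^ (n - 1) = α ^ (n - 1) * 1 := (mul_one _).symm
    _ ≤ α ^ (n - 1) * d j := mul_le_mul_of_nonneg_left hj (pow_nonneg h.alpha_pos.le _)
    _ ≤ d i := h.pow_mul_le (fun k => half_le_self (h.pos k).le) hd0 hBd i j

end IsIrreducibleSystem

/-! ### Newton's method on a dominated system -/

/-- `G` has the same quadratic part as `F`, and constant and linear coefficients that are at most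
those of `F`. This is the relation between the systems for two parameter vectors. -/
structure IsDominatedBy {n : ℕ} (G F : QuadMap (Fin n) (Fin n)) : Prop where
  const_le : ∀ i, G.const i ≤ F.const i
  lin_le : ∀ i j, G.lin i j ≤ F.lin i j
  quad_eq : G.quad = F.quad

namespace IsDominatedBy

variable {n : ℕ} {F G : QuadMap (Fin n) (Fin n)} {q : Fin n → ℝ} {α : ℝ}

theorem refl (F : QuadMap (Fin n) (Fin n)) : F.IsDominatedBy F :=
  ⟨fun _ => le_rfl, fun _ _ => le_rfl, rfl⟩

theorem form_eq (hG : G.IsDominatedBy F) (i : Fin n) (u v : Fin n → ℝ) :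
    G.form i u v = F.form i u v := by
  simp only [form, hG.quad_eq]

theorem jac_le (hG : G.IsDominatedBy F) (x : Fin n → ℝ) (i j : Fin n) :
    G.jac x i j ≤ F.jac x i j := by
  rw [jac_apply, jac_apply, hG.quad_eq]
  linarith [hG.lin_le i j]

theorem eval_sub_eval (hG : G.IsDominatedBy F) (x : Fin n → ℝ) (i : Fin n) :
    F.eval x i - G.eval x i =
      (F.const i - G.const i) + ∑ j, (F.lin i j - G.lin i j) * x j := by
  simp only [eval, hG.form_eq, sub_mul, Finset.sum_sub_distrib]
  ring

theorem eval_le (hG : G.IsDominatedBy F) {x : Fin n → ℝ} (hx : 0 ≤ x) : G.eval x ≤ F.eval x := by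
  intro i
  rw [← sub_nonneg, hG.eval_sub_eval]
  exact add_nonneg (sub_nonneg.2 (hG.const_le i))
    (Finset.sum_nonneg fun j _ => mul_nonneg (sub_nonneg.2 (hG.lin_le i j)) (hx j))

/-- The matrix `1 - B(x)` is monotone, in particular non-singular, below the least fixed point;
unless the system is affine, `x` has to be strictly below it. -/
theorem isMonotoneMatrix_jac (hG : G.IsDominatedBy F) (h : F.IsIrreducibleSystem q α)
    {x : Fin n → ℝ} (hx0 : 0 ≤ x) (hxq : x ≤ q) (hlt : F.quad ≠ 0 → ∀ i, x i < q i) :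
    IsMonotoneMatrix (G.jac x) := by
  intro w hw
  rcases isEmpty_or_nonempty (Fin n) with hemp | ⟨⟨i₀⟩⟩
  · exact fun i => hemp.elim i
  obtain ⟨d, hd, -, hBd, hstrict⟩ := h.exists_cone i₀
  have hdpos : ∀ i, 0 < d i := fun i => (pow_pos h.alpha_pos _).trans_le (hd i)
  have hBB : ∀ i j, G.jac x i j ≤ F.jac q i j := fun i j =>
    (hG.jac_le x i j).trans (F.jac_mono hxq i j)
  have hvv : ∀ i, (G.jac x).mulVec d i ≤ (F.jac q).mulVec d i := fun i => by
    rw [mulVec_eq_sum_mul, mulVec_eq_sum_mul]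
    exact Finset.sum_le_sum fun j _ => mul_le_mul_of_nonneg_right (hBB i j) (hdpos j).le
  refine nonneg_of_mulVec_le (fun i j => G.jac_nonneg hx0 i j) hdpos
    (fun i => (hvv i).trans (hBd i)) ?_ hw
  rintro Z ⟨i₁, hi₁⟩ hZeq hZ
  -- On `Z` the rows of `B_G(x)` and `B_F(q)` agree, so that `Z` contains all indices.
  have hrow : ∀ i ∈ Z, ∀ j, G.jac x i j = F.jac q i j := by
    intro i hi j
    have h1 : (G.jac x).mulVec d i = (F.jac q).mulVec d i :=
      le_antisymm (hvv i) ((hBd i).trans (hZeq i hi).ge)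
    rw [mulVec_eq_sum_mul, mulVec_eq_sum_mul] at h1
    have h2 := (Finset.sum_eq_sum_iff_of_le fun j _ =>
      mul_le_mul_of_nonneg_right (hBB i j) (hdpos j).le).1 h1 j (Finset.mem_univ j)
    exact mul_right_cancel₀ (hdpos j).ne' h2
  have huniv : ∀ i, i ∈ Z := by
    intro i
    induction h.connected i₁ i with
    | refl => exact hi₁
    | @tail a b _ hab ih =>
      by_contra hb
      exact hab ((hrow a ih b).symm.trans (hZ a ih b hb))
  by_cases hquad : F.quad = 0
  · obtain ⟨i, hi⟩ := hstrict hquad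
    exact absurd (hZeq i (huniv i)) ((hvv i).trans_lt hi).ne
  · refine hquad (funext fun a => funext fun b => funext fun c => ?_)
    have h1 : F.jac x a b = F.jac q a b :=
      le_antisymm (F.jac_mono hxq a b) ((hrow a (huniv a) b).symm.le.trans (hG.jac_le x a b))
    rw [jac_apply, jac_apply] at h1
    have h2 : ∑ k, F.quad a b k * x k = ∑ k, F.quad a b k * q k := by linarith
    have h3 := (Finset.sum_eq_sum_iff_of_le fun k _ =>
      mul_le_mul_of_nonneg_left (hxq k) (F.quad_nonneg a b k)).1 h2 c (Finset.mem_univ c)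
    by_contra h4
    exact (hlt hquad c).ne (mul_left_cancel₀ h4 h3)

end IsDominatedBy

/-- `N` is the result of a Newton step from `x`, written without the inverse of `1 - B(x)`. -/
def IsNewtonStep {n : ℕ} (G : QuadMap (Fin n) (Fin n)) (x N : Fin n → ℝ) : Prop :=
  ∀ i, N i - (G.jac x).mulVec N i = G.eval x i - (G.jac x).mulVec x i

namespace IsNewtonStep

variable {n : ℕ} {F G : QuadMap (Fin n) (Fin n)} {q p x N : Fin n → ℝ} {α : ℝ}

theorem sub_eq (hN : G.IsNewtonStep x N) (p : Fin n → ℝ) (i : Fin n) :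
    (p - N) i - (G.jac x).mulVec (p - N) i =
      (p i - G.eval p i) + G.form i (p - x) (p - x) := by
  have h1 := hN i
  have h2 := G.eval_sub_linearization x p i
  rw [Matrix.mulVec_sub] at h2 ⊢
  simp only [Pi.sub_apply] at h2 ⊢
  linarith

theorem le_fixedPoint (hN : G.IsNewtonStep x N) (hM : IsMonotoneMatrix (G.jac x))
    (hxp : x ≤ p) (hp : p = G.eval p) : N ≤ p := by
  rw [← sub_nonneg]
  refine hM _ fun i => ?_
  rw [← sub_nonneg, hN.sub_eq p i, ← congrFun hp i, sub_self, zero_add]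
  exact G.form_nonneg i (sub_nonneg.2 hxp) (sub_nonneg.2 hxp)

/-- A Newton step from a point strictly below the least fixed point `q` of a non-affine dominating
system stays strictly below it: the set of coordinates where `q` is reached would be closed under
the edges of the dependency graph. -/
theorem lt_of_quad_ne_zero (hN : G.IsNewtonStep x N) (hG : G.IsDominatedBy F)
    (h : F.IsIrreducibleSystem q α) (hquad : F.quad ≠ 0) (hx0 : 0 ≤ x)
    (hxq : ∀ i, x i < q i) (hNq : N ≤ q) (i : Fin n) : N i < q i := by
  refine (hNq i).lt_of_ne fun hi₁ => ?_
  have hqx : 0 ≤ q - x := fun j => (sub_pos.2 (hxq j)).le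
  have hqN : 0 ≤ q - N := sub_nonneg.2 hNq
  have hmem : ∀ a, N a = q a →
      F.const a - G.const a = 0 ∧ (∀ j, F.lin a j = G.lin a j) ∧
      (∀ j k, F.quad a j k = 0) ∧ ∀ j, G.jac x a j ≠ 0 → N j = q j := by
    intro a ha
    have h1 := hN.sub_eq q a
    have h2 : (q - N) a = 0 := by simp [ha]
    have h3 : 0 ≤ (G.jac x).mulVec (q - N) a := by
      rw [mulVec_eq_sum_mul]
      exact Finset.sum_nonneg fun j _ => mul_nonneg (G.jac_nonneg hx0 a j) (hqN j)
    have h4 : q a - G.eval q a =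
        (F.const a - G.const a) + ∑ j, (F.lin a j - G.lin a j) * q j := by
      rw [← hG.eval_sub_eval, h.eval_eq]
    have h5 : 0 ≤ F.const a - G.const a := sub_nonneg.2 (hG.const_le a)
    have h6' : ∀ j ∈ Finset.univ, 0 ≤ (F.lin a j - G.lin a j) * q j := fun j _ =>
      mul_nonneg (sub_nonneg.2 (hG.lin_le a j)) (h.nonneg j)
    have h6 := Finset.sum_nonneg h6'
    have h7 := G.form_nonneg a hqx hqx
    rw [h2, h4] at h1
    have h8 : ∑ j, (F.lin a j - G.lin a j) * q j = 0 := by linarith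
    have h9 : G.form a (q - x) (q - x) = 0 := by linarith
    have h10 : (G.jac x).mulVec (q - N) a = 0 := by linarith
    refine ⟨by linarith, fun j => ?_, fun j k => ?_, fun j hj => ?_⟩
    · have := (Finset.sum_eq_zero_iff_of_nonneg h6').1 h8 j (Finset.mem_univ j)
      exact sub_eq_zero.1 ((mul_eq_zero.1 this).resolve_right (h.pos j).ne')
    · have h11 := G.quad_mul_le_form a hqx hqx j k
      rw [h9, hG.quad_eq] at h11
      by_contra h12
      have h13 := (F.quad_nonneg a j k).lt_of_ne' h12
      have h14 : 0 < (q - x) j * (q - x) k :=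
        mul_pos (sub_pos.2 (hxq j)) (sub_pos.2 (hxq k))
      exact absurd h11 (not_le.2 (mul_pos h13 h14))
    · rw [mulVec_eq_sum_mul] at h10
      have := (Finset.sum_eq_zero_iff_of_nonneg fun j _ =>
        mul_nonneg (G.jac_nonneg hx0 a j) (hqN j)).1 h10 j (Finset.mem_univ j)
      exact (sub_eq_zero.1 ((mul_eq_zero.1 this).resolve_left hj)).symm
  have hall : ∀ j, N j = q j := by
    intro j
    induction h.connected i j with
    | refl => exact hi₁
    | @tail a b _ hab ih =>
      obtain ⟨-, h2, h3, h4⟩ := hmem a ih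
      refine h4 b ?_
      have h5 : F.jac q a b = G.jac x a b := by
        simp [jac_apply, hG.quad_eq, h3, h2]
      rwa [← h5]
  exact hquad (funext fun a => funext fun b => funext fun c => (hmem a (hall a)).2.2.1 b c)

/-- A Newton step halves the distance to a fixed point `p`, measured with a cone vector `d`. -/
theorem sub_le_half (hN : G.IsNewtonStep x N) (hM : IsMonotoneMatrix (G.jac x))
    (hxp : x ≤ p) (hp : p = G.eval p) {d : Fin n → ℝ} (hd : (G.jac p).mulVec d ≤ d)
    {t : ℝ} (ht : 0 ≤ t) (hpx : p - x ≤ t • d) : p - N ≤ (t / 2) • d := by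
  rw [← sub_nonneg]
  refine hM _ fun i => ?_
  have h1 := hN.sub_eq p i
  rw [← congrFun hp i, sub_self, zero_add] at h1
  have h2 : G.form i (p - x) (p - x) ≤ t * G.form i d (p - x) := by
    rw [G.form_comm i d, ← G.form_smul_right]
    exact G.form_le_form_right i (sub_nonneg.2 hxp) hpx
  have h3 := G.jac_mulVec_sub x p d i
  have h4 := mul_le_mul_of_nonneg_left (hd i) (div_nonneg ht zero_le_two)
  rw [Matrix.mulVec_sub, Matrix.mulVec_smul]
  simp only [Pi.sub_apply, Pi.smul_apply, smul_eq_mul] at h1 ⊢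
  have h5 : t / 2 * (G.jac p).mulVec d i =
      t / 2 * (G.jac x).mulVec d i + t * G.form i d (p - x) := by
    rw [← sub_eq_iff_eq_add']
    rw [← mul_sub, h3]
    ring
  linarith

end IsNewtonStep

end QuadMap

namespace QuadMap

/-! ### Perturbation bounds -/

namespace IsIrreducibleSystem

variable {n : ℕ} {F : QuadMap (Fin n) (Fin n)} {q : Fin n → ℝ} {α : ℝ}

/-- The perturbation bound for affine systems. The least fixed point itself is the vector `v ≤ 1`
for which `(1 - B) v`, the vector of constant terms, has a coordinate that is not too small. -/
theorem mul_pow_le_of_quad_eq_zero (h : F.IsIrreducibleSystem q α) (hquad : F.quad = 0)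
    (hconst : ∀ i, F.const i ≠ 0 → α ^ 2 / 2 ≤ F.const i) {z δ : Fin n → ℝ}
    (hz : ∀ k, q k / 2 ≤ z k) (hzq : z ≤ q) (hδ0 : 0 ≤ δ) {C : ℝ} (hC : 0 ≤ C)
    (hδ : ∀ i, δ i - (F.jac z).mulVec δ i ≤ C) (i : Fin n) : δ i * α ^ (n + 2) ≤ n * C := by
  obtain ⟨k, hk⟩ := h.exists_const_ne_zero i
  have hz0 : 0 ≤ z := fun k => (half_pos (h.pos k)).le.trans (hz k)
  have hBq := h.jac_mulVec_self_of_quad_eq_zero hquad z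
  have hα := h.alpha_pos
  have hmain := ((IsDominatedBy.refl F).isMonotoneMatrix_jac h hz0 hzq
    fun h0 => absurd hquad h0).solution_le (F.jac_nonneg hz0) h.connected h.alpha_pos.le
    h.alpha_le_one (fun a b hab => h.edge a b hab z hz) (v := q) (k := k) (η := α ^ 2 / 2)
    (fun a => by rw [hBq]; linarith [F.const_nonneg a]) h.le_one (by positivity)
    (by rw [hBq]; linarith [hconst k hk]) hC hδ i
  refine le_trans (mul_le_mul_of_nonneg_left ?_ (hδ0 i)) hmain
  obtain ⟨N, rfl⟩ : ∃ N, n = N + 1 := ⟨n - 1, by have := Fin.pos i; omega⟩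
  rw [Nat.add_sub_cancel]
  calc α ^ (N + 1 + 2) = α ^ N * α ^ 2 * α := by ring
    _ ≤ α ^ N * α ^ 2 * (1 / 2) := mul_le_mul_of_nonneg_left h.alpha_le_half (by positivity)
    _ = α ^ N * (α ^ 2 / 2) := by ring

/-- The perturbation bound for systems with a non-zero quadratic part. With `δ = q - p` and a cone
vector `d`, some coordinate of `(1 - B((p + q) / 2)) d` is at least `F_i(d, δ)` for the quadratic
part `F_i` of a component, which is proportional to `‖δ‖`. -/
theorem sq_mul_pow_le_of_quad_ne_zero (h : F.IsIrreducibleSystem q α) {a b c : Fin n}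
    (hquad : α / 2 ≤ F.quad a b c) {p : Fin n → ℝ} (hp0 : 0 ≤ p) (hpq : p ≤ q) {C : ℝ}
    (hlow : (F.jac ((1 / 2 : ℝ) • (p + q))).mulVec (q - p) ≤ q - p)
    (hδ : ∀ i, (q - p) i - (F.jac ((1 / 2 : ℝ) • (p + q))).mulVec (q - p) i ≤ C) (i : Fin n) :
    (q - p) i ^ 2 * α ^ (3 * n + 1) ≤ 2 * (n * C) := by
  have hne : Nonempty (Fin n) := ⟨i⟩
  set z := (1 / 2 : ℝ) • (p + q) with hzdef
  set δ := q - p with hδdef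
  have hα := h.alpha_pos
  have hδ0 : 0 ≤ δ := sub_nonneg.2 hpq
  have hC : 0 ≤ C := (sub_nonneg.2 (hlow i)).trans (hδ i)
  obtain ⟨j, hj⟩ := Finite.exists_max δ
  rcases (show 0 ≤ δ j from hδ0 j).eq_or_lt with hj0 | hj0
  · have : δ i = 0 := le_antisymm ((hj i).trans hj0.ge) (hδ0 i)
    rw [this]
    simp only [ne_eq, OfNat.ofNat_ne_zero, not_false_eq_true, zero_pow, zero_mul]
    positivity
  have hzk : ∀ k, z k = (p k + q k) / 2 := fun k => by
    simp only [hzdef, Pi.smul_apply, Pi.add_apply, smul_eq_mul]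
    ring
  have hz : ∀ k, q k / 2 ≤ z k := fun k => by
    have : 0 ≤ p k := hp0 k
    rw [hzk]
    linarith
  have hz0 : 0 ≤ z := fun k => (half_pos (h.pos k)).le.trans (hz k)
  have hzq : z ≤ q := fun k => by
    rw [hzk]
    linarith [hpq k]
  have hspread : ∀ k, α ^ (n - 1) * δ j ≤ δ k := fun k => h.pow_mul_le hz hδ0 hlow k j
  have hzlt : ∀ k, z k < q k := fun k => by
    have h1 : 0 < δ k := lt_of_lt_of_le (mul_pos (pow_pos hα _) hj0) (hspread k)
    have h2 : δ k = q k - p k := rfl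
    rw [hzk]
    linarith
  obtain ⟨d, hd, hd1, hBd, -⟩ := h.exists_cone i
  have hd0 : 0 ≤ d := fun k => (pow_pos hα _).le.trans (hd k)
  have hdz : ∀ k, F.form k d δ ≤ d k - (F.jac z).mulVec d k := fun k => by
    have h1 := F.jac_mulVec_sub z q d k
    have h2 : q - z = (1 / 2 : ℝ) • δ := by
      funext l
      simp only [hδdef, Pi.sub_apply, Pi.smul_apply, smul_eq_mul, hzk]
      ring
    rw [h2, form_smul_right] at h1
    linarith [hBd k]
  have hη : α / 2 * (α ^ (n - 1) * (α ^ (n - 1) * δ j)) ≤ d a - (F.jac z).mulVec d a :=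
    calc α / 2 * (α ^ (n - 1) * (α ^ (n - 1) * δ j))
        ≤ F.quad a b c * (d b * δ c) := by
          have := hd b
          have := hspread c
          have : 0 ≤ d b := hd0 b
          gcongr
          exact F.quad_nonneg a b c
      _ ≤ F.form a d δ := F.quad_mul_le_form a hd0 hδ0 b c
      _ ≤ _ := hdz a
  have hmain := ((IsDominatedBy.refl F).isMonotoneMatrix_jac h hz0 hzq
    fun _ => hzlt).solution_le (F.jac_nonneg hz0) h.connected hα.le
    h.alpha_le_one (fun a b hab => h.edge a b hab z hz) (v := d) (k := a)
    (η := α / 2 * (α ^ (n - 1) * (α ^ (n - 1) * δ j)))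
    (fun k => sub_nonneg.1 ((F.form_nonneg k hd0 hδ0).trans (hdz k))) hd1 (by positivity)
    hη hC hδ j
  have hpow : α ^ (3 * n + 1) ≤ α ^ (n - 1) * α ^ (n - 1) * α ^ (n - 1) * α := by
    rw [← pow_add, ← pow_add, ← pow_succ]
    exact pow_le_pow_of_le_one hα.le h.alpha_le_one (by omega)
  calc δ i ^ 2 * α ^ (3 * n + 1)
      ≤ δ j ^ 2 * (α ^ (n - 1) * α ^ (n - 1) * α ^ (n - 1) * α) := by
        gcongr
        · exact hδ0 i
        · exact hj i
    _ = 2 * (δ j * (α ^ (n - 1) * (α / 2 * (α ^ (n - 1) * (α ^ (n - 1) * δ j))))) := by ring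
    _ ≤ 2 * (n * C) := by gcongr

end IsIrreducibleSystem

end QuadMap

/-! ### The rounded-down Newton method -/

theorem roundDown_nonneg (h : ℕ) (t : ℝ) : 0 ≤ roundDown h t := by
  unfold roundDown
  have : 0 ≤ ⌊max t 0 * 2 ^ h⌋ := Int.floor_nonneg.2 (by positivity)
  positivity

theorem roundDown_le (h : ℕ) (t : ℝ) : roundDown h t ≤ max t 0 := by
  unfold roundDown
  rw [div_le_iff₀ (by positivity)]
  exact Int.floor_le _

theorem le_roundDown_add (h : ℕ) (t : ℝ) : t ≤ roundDown h t + 1 / 2 ^ h := by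
  unfold roundDown
  rw [← add_div, le_div_iff₀ (by positivity)]
  exact (mul_le_mul_of_nonneg_right (le_max_left t 0) (by positivity)).trans
    (Int.lt_floor_add_one _).le

section Newton

variable {n : ℕ} {Q : Fin n → MvPolynomial (Fin n) ℝ} {F G : QuadMap (Fin n) (Fin n)}
  {q p : Fin n → ℝ} {α : ℝ}

theorem isNewtonStep_newton (hev : evalVec Q = G.eval) (hjac : jacobian Q = G.jac)
    {x : Fin n → ℝ} (hx : IsUnit (1 - G.jac x)) : G.IsNewtonStep x (newton Q x) := by
  have hdet := (Matrix.isUnit_iff_isUnit_det _).1 hx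
  have h1 : (1 - G.jac x).mulVec (newton Q x) =
      (1 - G.jac x).mulVec x + (G.eval x - x) := by
    rw [newton, hev, hjac, Matrix.mulVec_add, Matrix.mulVec_mulVec, Matrix.mul_nonsing_inv _ hdet,
      Matrix.one_mulVec]
  intro i
  have h2 := congrFun h1 i
  simp only [Matrix.sub_mulVec, Matrix.one_mulVec, Pi.sub_apply, Pi.add_apply] at h2
  linarith

/-- The invariants of the rounded-down Newton method. In the last one, `d` is a cone vector and
`β` a lower bound for its entries; a Newton step halves the factor in front of `d`, and rounding
adds at most `2⁻ʰ / β` to it. -/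
theorem rnm_invariant (hev : evalVec Q = G.eval) (hjac : jacobian Q = G.jac)
    (hG : G.IsDominatedBy F) (hF : F.IsIrreducibleSystem q α) (hp : G.IsLeastFixedPoint p)
    (hpq : p ≤ q) {d : Fin n → ℝ} (hd : (F.jac q).mulVec d ≤ d) {β : ℝ} (hβ : 0 < β)
    (hβd : ∀ i, β ≤ d i) (h k : ℕ) :
    0 ≤ rnm Q h k ∧ rnm Q h k ≤ p ∧ (F.quad ≠ 0 → ∀ i, rnm Q h k i < q i) ∧
      p - rnm Q h k ≤ (((1 / 2) ^ k + 2 / 2 ^ h) / β) • d := by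
  have hp0 : 0 ≤ p := hp.1.1
  have hd0 : 0 ≤ d := fun i => hβ.le.trans (hβd i)
  induction k with
  | zero =>
    refine ⟨le_rfl, hp0, fun _ => hF.pos, fun i => ?_⟩
    simp only [rnm, sub_zero, pow_zero, Pi.smul_apply, smul_eq_mul]
    have h1 : (1 : ℝ) ≤ 1 + 2 / 2 ^ h := le_add_of_nonneg_right (by positivity)
    calc p i ≤ 1 := (hpq i).trans (hF.le_one i)
      _ = 1 / β * β := by field_simp
      _ ≤ (1 + 2 / 2 ^ h) / β * d i := by
        have := hβd i
        gcongr
  | succ k ih =>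
    obtain ⟨hx0, hxp, hxq, hxd⟩ := ih
    set x := rnm Q h k with hx
    have hM := hG.isMonotoneMatrix_jac hF hx0 (hxp.trans hpq) hxq
    have hN := isNewtonStep_newton hev hjac hM.isUnit
    have hNp := hN.le_fixedPoint hM hxp hp.1.2
    have hstep : ∀ i, rnm Q h (k + 1) i = roundDown h (newton Q x i) := fun i => rfl
    have hle : ∀ i, rnm Q h (k + 1) i ≤ max (newton Q x i) 0 := fun i => roundDown_le h _
    refine ⟨fun i => roundDown_nonneg h _, fun i => (hle i).trans (max_le (hNp i) (hp0 i)),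
      fun hquad i => (hle i).trans_lt (max_lt ?_ (hF.pos i)), fun i => ?_⟩
    · exact hN.lt_of_quad_ne_zero hG hF hquad hx0 (hxq hquad) (hNp.trans hpq) i
    · have hdp : (G.jac p).mulVec d ≤ d := fun j => by
        refine le_trans ?_ (hd j)
        rw [mulVec_eq_sum_mul, mulVec_eq_sum_mul]
        exact Finset.sum_le_sum fun l _ => mul_le_mul_of_nonneg_right
          ((hG.jac_le p j l).trans (F.jac_mono hpq j l)) (hd0 l)
      have h1 := hN.sub_le_half hM hxp hp.1.2 hdp (by positivity) hxd i
      have h2 := le_roundDown_add h (newton Q x i)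
      have h3 : (1 : ℝ) / 2 ^ h ≤ 1 / 2 ^ h / β * d i := by
        rw [div_mul_eq_mul_div, le_div_iff₀ hβ]
        exact mul_le_mul_of_nonneg_left (hβd i) (by positivity)
      simp only [Pi.sub_apply, Pi.smul_apply, smul_eq_mul, hstep] at h1 ⊢
      calc p i - roundDown h (newton Q x i)
          ≤ ((1 / 2) ^ k + 2 / 2 ^ h) / β / 2 * d i + 1 / 2 ^ h / β * d i := by linarith
        _ = ((1 / 2) ^ (k + 1) + 2 / 2 ^ h) / β * d i := by ring

theorem newtonDefined_rnm (hev : evalVec Q = G.eval) (hjac : jacobian Q = G.jac)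
    (hG : G.IsDominatedBy F) (hF : F.IsIrreducibleSystem q α) (hp : G.IsLeastFixedPoint p)
    (hpq : p ≤ q) (h k : ℕ) : NewtonDefined Q (rnm Q h k) := by
  rw [NewtonDefined, hjac]
  rcases isEmpty_or_nonempty (Fin n) with hemp | ⟨⟨i₀⟩⟩
  · rw [Subsingleton.elim (1 - G.jac (rnm Q h k)) 1]
    exact isUnit_one
  obtain ⟨d, hd, -, hBd, -⟩ := hF.exists_cone i₀
  obtain ⟨h0, h1, h2, -⟩ :=
    rnm_invariant hev hjac hG hF hp hpq hBd (pow_pos hF.alpha_pos _) hd h k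
  exact (hG.isMonotoneMatrix_jac hF h0 (h1.trans hpq) h2).isUnit

theorem two_pow_ge_of_ceil_le (n : ℕ) {α ε : ℝ} (hα : 0 < α) (hε : 0 < ε) {h : ℕ}
    (hh : ⌈2 + (n : ℝ) * Real.logb 2 (1 / α) + Real.logb 2 (1 / ε)⌉ ≤ (h : ℤ)) :
    4 ≤ ε * α ^ n * 2 ^ h := by
  have h1 : 2 + (n : ℝ) * Real.logb 2 (1 / α) + Real.logb 2 (1 / ε) ≤ (h : ℝ) := by
    exact_mod_cast Int.ceil_le.1 hh
  have h2 := Real.rpow_le_rpow_of_exponent_le (one_le_two (α := ℝ)) h1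
  have hα' : 0 < 1 / α := by positivity
  have hε' : 0 < 1 / ε := by positivity
  rw [Real.rpow_add two_pos, Real.rpow_add two_pos, mul_comm (n : ℝ), Real.rpow_mul two_pos.le,
    Real.rpow_logb two_pos (by norm_num) hα', Real.rpow_logb two_pos (by norm_num) hε',
    Real.rpow_natCast, Real.rpow_natCast, Real.rpow_two, one_div, one_div, inv_pow] at h2
  have h3 := mul_le_mul_of_nonneg_left h2 (by positivity : 0 ≤ ε * α ^ n)
  calc (4 : ℝ) = ε * α ^ n * (2 ^ 2 * (α ^ n)⁻¹ * ε⁻¹) := by field_simp; norm_num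
    _ ≤ _ := h3

theorem norm_sub_rnm_le (hev : evalVec Q = G.eval) (hjac : jacobian Q = G.jac)
    (hG : G.IsDominatedBy F) (hF : F.IsIrreducibleSystem q α) (hp : G.IsLeastFixedPoint p)
    (hpq : p ≤ q) {ε : ℝ} (hε : 0 < ε) {h g : ℕ}
    (hh : ⌈2 + (n : ℝ) * Real.logb 2 (1 / α) + Real.logb 2 (1 / ε)⌉ ≤ (h : ℤ))
    (hg : (h : ℤ) - 1 ≤ (g : ℤ)) : ‖p - rnm Q h g‖ ≤ ε := by
  rw [pi_norm_le_iff_of_nonneg hε.le]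
  intro i
  have hα := hF.alpha_pos
  obtain ⟨d, hd, hd1, hBd, -⟩ := hF.exists_cone i
  obtain ⟨-, h1, -, h2⟩ := rnm_invariant hev hjac hG hF hp hpq hBd (pow_pos hα _) hd h g
  have h3 : (0 : ℝ) ≤ p i - rnm Q h g i := sub_nonneg.2 (h1 i)
  rw [Pi.sub_apply, Real.norm_of_nonneg h3]
  have hg' : (1 / 2 : ℝ) ^ g ≤ 2 / 2 ^ h := by
    calc (1 / 2 : ℝ) ^ g ≤ 2 * (1 / 2) ^ (g + 1) := by rw [pow_succ]; linarith
      _ ≤ 2 * (1 / 2) ^ h := by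
        gcongr 2 * ?_
        exact pow_le_pow_of_le_one (by norm_num) (by norm_num) (by omega)
      _ = 2 / 2 ^ h := by rw [one_div, inv_pow]; rfl
  have hpow : α ^ n ≤ α ^ (n - 1) :=
    pow_le_pow_of_le_one hα.le hF.alpha_le_one (Nat.sub_le n 1)
  calc p i - rnm Q h g i ≤ ((1 / 2) ^ g + 2 / 2 ^ h) / α ^ (n - 1) * d i := h2 i
    _ ≤ (2 / 2 ^ h + 2 / 2 ^ h) / α ^ n * 1 := by
      have := hd1 i
      gcongr
      exact (pow_pos hα _).le.trans (hd i)
    _ = 4 / (α ^ n * 2 ^ h) := by field_simp; norm_num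
    _ ≤ ε := by
      rw [div_le_iff₀ (by positivity), ← mul_assoc]
      exact two_pow_ge_of_ceil_le n hα hε hh

end Newton

/-! ### Quadratic maps and vectors of polynomials -/

/-- `p` is a polynomial of degree at most two, all of whose non-zero constant, linear and
(symmetrized) quadratic coefficients are at least `μ`, `μ` and `μ / 2`. -/
def IsQuadraticAbove {σ : Type*} [Fintype σ] (μ : ℝ) (p : MvPolynomial σ ℝ) : Prop :=
  ∃ (c : ℝ) (l : σ → ℝ) (a : σ → σ → ℝ), (c = 0 ∨ μ ≤ c) ∧ (∀ s, l s = 0 ∨ μ ≤ l s) ∧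
    (∀ s t, a s t = 0 ∨ μ / 2 ≤ a s t) ∧ (∀ s t, a s t = a t s) ∧
    p = MvPolynomial.C c + ∑ s, MvPolynomial.C (l s) * MvPolynomial.X s +
      ∑ s, ∑ t, MvPolynomial.C (a s t) * (MvPolynomial.X s * MvPolynomial.X t)

namespace IsQuadraticAbove

open MvPolynomial

variable {σ : Type*} [Fintype σ] {μ : ℝ}

theorem zero_or_le_add {a b μ : ℝ} (hμ : 0 ≤ μ) (ha : a = 0 ∨ μ ≤ a) (hb : b = 0 ∨ μ ≤ b) :
    a + b = 0 ∨ μ ≤ a + b := by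
  rcases ha with rfl | ha <;> rcases hb with rfl | hb
  · simp
  · right; linarith
  · right; linarith
  · right; linarith

theorem zero : IsQuadraticAbove μ (0 : MvPolynomial σ ℝ) :=
  ⟨0, 0, 0, by simp, by simp, by simp, by simp, by simp⟩

theorem add (hμ : 0 ≤ μ) {p q : MvPolynomial σ ℝ} (hp : IsQuadraticAbove μ p)
    (hq : IsQuadraticAbove μ q) : IsQuadraticAbove μ (p + q) := by
  obtain ⟨c, l, a, hc, hl, ha, hs, rfl⟩ := hp
  obtain ⟨c', l', a', hc', hl', ha', hs', rfl⟩ := hq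
  refine ⟨c + c', l + l', a + a', zero_or_le_add hμ hc hc',
    fun s => zero_or_le_add hμ (hl s) (hl' s),
    fun s t => zero_or_le_add (by linarith) (ha s t) (ha' s t), fun s t => ?_, ?_⟩
  · simp only [Pi.add_apply, hs s t, hs' s t]
  · simp only [Pi.add_apply, map_add, add_mul, Finset.sum_add_distrib]
    ring

theorem monomial (hμ : 0 < μ) {d : σ →₀ ℕ} (hd : d.degree ≤ 2) {c : ℝ} (hc : μ ≤ c) :
    IsQuadraticAbove μ (MvPolynomial.monomial d c) := by
  classical
  have hsplit : ∀ e : σ →₀ ℕ, e ≠ 0 →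
      ∃ s e', e = Finsupp.single s 1 + e' ∧ e.degree = 1 + e'.degree := by
    intro e he
    obtain ⟨s, hs⟩ : ∃ s, e s ≠ 0 := by
      by_contra hcon
      push Not at hcon
      exact he (Finsupp.ext hcon)
    have h1 : Finsupp.single s 1 ≤ e :=
      Finsupp.single_le_iff.2 (Nat.one_le_iff_ne_zero.2 hs)
    have h2 : e = Finsupp.single s 1 + (e - Finsupp.single s 1) := (add_tsub_cancel_of_le h1).symm
    refine ⟨s, e - Finsupp.single s 1, h2, ?_⟩
    conv_lhs => rw [h2]
    rw [map_add, Finsupp.degree_single]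
  by_cases h0 : d = 0
  · subst h0
    exact ⟨c, 0, 0, Or.inr hc, by simp, by simp, by simp, by simp⟩
  obtain ⟨s, d', rfl, hdeg⟩ := hsplit d h0
  by_cases h1 : d' = 0
  · subst h1
    refine ⟨0, Pi.single s c, 0, by simp, fun t => ?_, by simp, by simp, ?_⟩
    · rcases eq_or_ne t s with rfl | hts
      · simp [hc]
      · simp [hts]
    · simp [Pi.single_apply, apply_ite C, ite_mul, C_mul_X_eq_monomial]
  obtain ⟨t, d'', rfl, hdeg'⟩ := hsplit d' h1
  have h2 : d'' = 0 := by
    rw [← Finsupp.degree_eq_zero_iff]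
    omega
  subst h2
  refine ⟨0, 0, fun u v => (if u = s then if v = t then c / 2 else 0 else 0) +
    (if u = t then if v = s then c / 2 else 0 else 0), by simp, by simp, fun u v => ?_,
    fun u v => ?_, ?_⟩
  · refine zero_or_le_add (by linarith) ?_ ?_ <;> split_ifs <;>
      first
      | exact Or.inl rfl
      | (right; linarith)
  · simp only [← ite_and]
    rw [add_comm]
    simp only [and_comm]
  · have h3 : MvPolynomial.monomial (Finsupp.single s 1 + (Finsupp.single t 1 + 0)) c =
        C (c / 2) * (X s * X t) + C (c / 2) * (X t * X s) := by
      rw [mul_comm (X t), ← add_mul, ← C_add, add_halves, X, X, monomial_mul, C_mul_monomial]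
      simp
    rw [h3]
    simp [add_mul, Finset.sum_add_distrib, apply_ite C, ite_mul]

theorem of_coeff (hμ : 0 < μ) {p : MvPolynomial σ ℝ} (hdeg : p.totalDegree ≤ 2)
    (hp : ∀ d, p.coeff d ≠ 0 → μ ≤ p.coeff d) : IsQuadraticAbove μ p := by
  rw [← p.support_sum_monomial_coeff]
  refine Finset.sum_induction _ _ (fun _ _ => add hμ.le) zero fun d hd => monomial hμ ?_ ?_
  · exact (le_totalDegree hd).trans hdeg
  · exact hp d (mem_support_iff.1 hd)

end IsQuadraticAbove

namespace QuadMap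

/-- The components of a quadratic map as polynomials. -/
noncomputable def toPoly {ι σ : Type*} [Fintype σ] (F : QuadMap ι σ) (i : ι) : MvPolynomial σ ℝ :=
  MvPolynomial.C (F.const i) + ∑ s, MvPolynomial.C (F.lin i s) * MvPolynomial.X s +
    ∑ s, ∑ t, MvPolynomial.C (F.quad i s t) * (MvPolynomial.X s * MvPolynomial.X t)

section Poly

variable {ι σ : Type*} [Fintype σ] (F : QuadMap ι σ)

theorem eval_toPoly (x : σ → ℝ) (i : ι) : MvPolynomial.eval x (F.toPoly i) = F.eval x i := by
  simp [toPoly, eval, form]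

theorem evalVec_toPoly : evalVec F.toPoly = F.eval :=
  funext fun x => funext fun i => F.eval_toPoly x i

theorem pderiv_toPoly (i : ι) (j : σ) : MvPolynomial.pderiv j (F.toPoly i) =
    MvPolynomial.C (F.lin i j) + ∑ t, MvPolynomial.C (2 * F.quad i j t) * MvPolynomial.X t := by
  classical
  simp only [toPoly, map_add, map_sum, MvPolynomial.pderiv_C,
    MvPolynomial.pderiv_mul, MvPolynomial.pderiv_X, zero_add, mul_add, Finset.sum_add_distrib]
  simp only [Pi.single_apply, ite_mul, mul_ite, one_mul, mul_one, zero_mul, mul_zero,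
    Finset.sum_ite_eq', Finset.mem_univ, if_true]
  have h : ∑ s, ∑ t, (if s = j then
      MvPolynomial.C (F.quad i s t) * (MvPolynomial.X t : MvPolynomial σ ℝ) else 0) =
      ∑ t, MvPolynomial.C (F.quad i j t) * MvPolynomial.X t := by
    rw [Finset.sum_comm]
    simp only [Finset.sum_ite_eq', Finset.mem_univ, if_true]
  rw [h]
  simp only [Finset.sum_const_zero, zero_add, ← Finset.sum_add_distrib, F.quad_symm i _ j]
  congr 1
  refine Finset.sum_congr rfl fun t _ => ?_
  rw [two_mul, map_add]
  ring

theorem jacobian_toPoly {n : ℕ} (F : QuadMap (Fin n) (Fin n)) : jacobian F.toPoly = F.jac := by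
  funext x
  ext i j
  rw [jacobian, Matrix.of_apply, pderiv_toPoly, jac_apply]
  simp [Finset.mul_sum, mul_assoc]

theorem exists_eq_toPoly {μ : ℝ} (hμ : 0 < μ) {P : ι → MvPolynomial σ ℝ}
    (hP : ∀ i, IsQuadraticAbove μ (P i)) :
    ∃ F : QuadMap ι σ, P = F.toPoly ∧ (∀ i, F.const i = 0 ∨ μ ≤ F.const i) ∧
      (∀ i s, F.lin i s = 0 ∨ μ ≤ F.lin i s) ∧
      ∀ i s t, F.quad i s t = 0 ∨ μ / 2 ≤ F.quad i s t := by
  choose c l a hc hl ha hs hP using hP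
  have hnn : ∀ {b ν : ℝ}, 0 < ν → b = 0 ∨ ν ≤ b → 0 ≤ b := fun hν h =>
    h.elim (fun h => h.ge) fun h => hν.le.trans h
  exact ⟨⟨c, l, a, fun i => hnn hμ (hc i), fun i s => hnn hμ (hl i s),
    fun i s t => hnn (half_pos hμ) (ha i s t), hs⟩, funext hP, hc, hl, ha⟩

end Poly

/-- The quadratic map in `x` that arises from one in `(x, y)` by fixing `y`. -/
def plug {n m : ℕ} (F : QuadMap (Fin n) (Fin n ⊕ Fin m)) (y : Fin m → ℝ) (hy : 0 ≤ y) :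
    QuadMap (Fin n) (Fin n) where
  const i := F.const i + ∑ k, F.lin i (.inr k) * y k +
    ∑ k, ∑ l, F.quad i (.inr k) (.inr l) * (y k * y l)
  lin i j := F.lin i (.inl j) + 2 * ∑ k, F.quad i (.inl j) (.inr k) * y k
  quad i j k := F.quad i (.inl j) (.inl k)
  const_nonneg i := add_nonneg (add_nonneg (F.const_nonneg i)
    (Finset.sum_nonneg fun k _ => mul_nonneg (F.lin_nonneg _ _) (hy k)))
    (Finset.sum_nonneg fun k _ => Finset.sum_nonneg fun l _ =>
      mul_nonneg (F.quad_nonneg _ _ _) (mul_nonneg (hy k) (hy l)))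
  lin_nonneg _ _ := add_nonneg (F.lin_nonneg _ _) (mul_nonneg zero_le_two
    (Finset.sum_nonneg fun k _ => mul_nonneg (F.quad_nonneg _ _ _) (hy k)))
  quad_nonneg _ _ _ := F.quad_nonneg _ _ _
  quad_symm _ _ _ := F.quad_symm _ _ _

section Plug

variable {n m : ℕ} (F : QuadMap (Fin n) (Fin n ⊕ Fin m))

theorem eval_plug (y : Fin m → ℝ) (hy : 0 ≤ y) (x : Fin n → ℝ) :
    (F.plug y hy).eval x = F.eval (Sum.elim x y) := by
  funext i
  have h1 : ∑ k, ∑ j, F.quad i (.inr k) (.inl j) * (y k * x j) =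
      ∑ j, ∑ k, F.quad i (.inl j) (.inr k) * (x j * y k) := by
    rw [Finset.sum_comm]
    refine Finset.sum_congr rfl fun j _ => Finset.sum_congr rfl fun k _ => ?_
    rw [F.quad_symm, mul_comm (y k)]
  have h2 : ∑ j, (F.plug y hy).lin i j * x j = ∑ j, F.lin i (.inl j) * x j +
      2 * ∑ j, ∑ k, F.quad i (.inl j) (.inr k) * (x j * y k) := by
    rw [Finset.mul_sum, ← Finset.sum_add_distrib]
    refine Finset.sum_congr rfl fun j _ => ?_
    simp only [plug, add_mul, mul_assoc, Finset.sum_mul]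
    simp only [mul_comm (y _)]
  rw [eval, h2]
  simp only [eval, form, plug, Fintype.sum_sum_type, Sum.elim_inl, Sum.elim_inr,
    Finset.sum_add_distrib, h1]
  ring

theorem plug_toPoly (y : Fin m → ℝ) (hy : 0 ≤ y) :
    MPS.plug F.toPoly y = (F.plug y hy).toPoly := by
  funext i
  apply MvPolynomial.funext
  intro x
  rw [eval_toPoly, eval_plug, ← eval_toPoly, MPS.plug, MvPolynomial.aeval_def,
    MvPolynomial.algebraMap_eq, ← MvPolynomial.coe_eval₂Hom, ← RingHom.comp_apply]
  congr 1
  apply MvPolynomial.ringHom_ext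
  · intro r
    simp
  · rintro (j | k) <;> simp

theorem plug_isDominatedBy {y₁ y₂ : Fin m → ℝ} (h₁ : 0 ≤ y₁) (h₂ : 0 ≤ y₂) (h : y₂ ≤ y₁) :
    (F.plug y₂ h₂).IsDominatedBy (F.plug y₁ h₁) where
  const_le i := by
    simp only [plug]
    gcongr with k _ k _ l
    · exact F.lin_nonneg _ _
    · exact h k
    · exact F.quad_nonneg _ _ _
    · exact h₂ l
    · exact h₁ k
    · exact h k
    · exact h l
  lin_le i j := by
    simp only [plug]
    gcongr with k
    · exact F.quad_nonneg _ _ _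
    · exact h k
  quad_eq := rfl

end Plug

end QuadMap

theorem QuadMap.isLFP_toPoly_iff {n : ℕ} (F : QuadMap (Fin n) (Fin n)) (q : Fin n → ℝ) :
    IsLFP F.toPoly q ↔ F.IsLeastFixedPoint q := by
  rw [IsLFP, QuadMap.evalVec_toPoly, QuadMap.IsLeastFixedPoint]

theorem QuadMap.jac_ne_zero_of_dependsOn {n : ℕ} (F : QuadMap (Fin n) (Fin n)) {q : Fin n → ℝ}
    (hq : ∀ i, 0 < q i) {i j : Fin n} (h : DependsOn F.toPoly i j) : F.jac q i j ≠ 0 := by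
  classical
  intro h0
  obtain ⟨d, hd, hdj⟩ := h
  have hq0 : 0 ≤ q := fun k => (hq k).le
  have hlin : F.lin i j = 0 :=
    le_antisymm ((F.lin_le_jac hq0 i j).trans h0.le) (F.lin_nonneg i j)
  have hquad : ∀ k, F.quad i j k = 0 := fun k => by
    have h1 := (F.quad_le_jac hq0 i j k).trans h0.le
    have h2 : F.quad i j k * q k ≤ 0 * q k := by linarith
    exact le_antisymm (le_of_mul_le_mul_right h2 (hq k)) (F.quad_nonneg i j k)
  have hp : MvPolynomial.pderiv j (F.toPoly i) = 0 := by
    rw [QuadMap.pderiv_toPoly]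
    simp [hlin, hquad]
  have h1 := congrArg (MvPolynomial.coeff (d - Finsupp.single j 1)) hp
  have h2 : d - Finsupp.single j 1 + Finsupp.single j 1 = d :=
    tsub_add_cancel_of_le (Finsupp.single_le_iff.2 (Nat.one_le_iff_ne_zero.2 hdj))
  rw [MvPolynomial.coeff_pderiv, h2, MvPolynomial.coeff_zero] at h1
  exact (mul_pos hd (Nat.cast_add_one_pos _)).ne' h1

theorem QuadMap.quad_eq_zero_of_isLinear {n : ℕ} (F : QuadMap (Fin n) (Fin n))
    (h : IsLinear F.toPoly) : F.quad = 0 := by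
  classical
  funext i j k
  have h1 : MvPolynomial.coeff (Finsupp.single k 1) (MvPolynomial.pderiv j (F.toPoly i)) = 0 := by
    rw [MvPolynomial.coeff_pderiv, MvPolynomial.coeff_eq_zero_of_totalDegree_lt, zero_mul]
    refine (h i).trans_lt ?_
    change 1 < Finsupp.degree _
    rw [map_add, Finsupp.degree_single, Finsupp.degree_single]
    norm_num
  rw [QuadMap.pderiv_toPoly] at h1
  simp only [MvPolynomial.coeff_add, MvPolynomial.coeff_sum, MvPolynomial.coeff_C_mul,
    MvPolynomial.coeff_C, MvPolynomial.coeff_X] at h1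
  simpa [Finsupp.single_left_inj, eq_comm] using h1

/-! ### The constant `α` -/

section Alpha

variable {n m : ℕ} {F : QuadMap (Fin n) (Fin n ⊕ Fin m)} {y : Fin m → ℝ} {q : Fin n → ℝ}
  {κ ν : ℝ}

/-- If the non-zero coefficients of `F` are at least `κ` (up to symmetrization), and `ν ≤ 1` is a
lower bound for the parameters, then the non-zero linear coefficients in `x` are at least `κ ν`:
they come from a linear coefficient of `F`, or from a mixed one times a parameter. -/
theorem QuadMap.mul_le_lin_plug (hκ : 0 < κ) (hν : 0 < ν) (hν1 : ν ≤ 1)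
    (hlin : ∀ i s, F.lin i s = 0 ∨ κ ≤ F.lin i s)
    (hquad : ∀ i s t, F.quad i s t = 0 ∨ κ / 2 ≤ F.quad i s t)
    (hy : 0 ≤ y) (hνy : ∀ k, ν ≤ y k) {i j : Fin n} (h : (F.plug y hy).lin i j ≠ 0) :
    κ * ν ≤ (F.plug y hy).lin i j := by
  have hterm : ∀ k, 0 ≤ F.quad i (.inl j) (.inr k) * y k := fun k =>
    mul_nonneg (F.quad_nonneg _ _ _) (hy k)
  have hsum : 0 ≤ ∑ k, F.quad i (.inl j) (.inr k) * y k := Finset.sum_nonneg fun k _ => hterm k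
  have hl0 := F.lin_nonneg i (.inl j)
  simp only [plug] at h ⊢
  rcases hlin i (.inl j) with hl | hl
  · obtain ⟨k, -, hk⟩ : ∃ k ∈ Finset.univ, F.quad i (.inl j) (.inr k) * y k ≠ 0 := by
      apply Finset.exists_ne_zero_of_sum_ne_zero
      intro h0
      exact h (by rw [hl, h0]; simp)
    have h1 := (hquad i (.inl j) (.inr k)).resolve_left (left_ne_zero_of_mul hk)
    have h2 : κ / 2 * ν ≤ F.quad i (.inl j) (.inr k) * y k := by
      have := hνy k
      gcongr
      exact F.quad_nonneg _ _ _
    have h3 := Finset.single_le_sum (f := fun k => F.quad i (.inl j) (.inr k) * y k)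
      (fun k _ => hterm k) (Finset.mem_univ k)
    linarith
  · have : κ * ν ≤ κ := mul_le_of_le_one_right hκ.le hν1
    linarith

theorem QuadMap.mul_le_jac_plug (hκ : 0 < κ) (hν : 0 < ν) (hν1 : ν ≤ 1)
    (hlin : ∀ i s, F.lin i s = 0 ∨ κ ≤ F.lin i s)
    (hquad : ∀ i s t, F.quad i s t = 0 ∨ κ / 2 ≤ F.quad i s t)
    (hy : 0 ≤ y) (hνy : ∀ k, ν ≤ y k) (hνq : ∀ k, ν ≤ q k / 2) {i j : Fin n}
    (h : (F.plug y hy).jac q i j ≠ 0) {z : Fin n → ℝ} (hz : ∀ k, q k / 2 ≤ z k) :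
    κ * ν ≤ (F.plug y hy).jac z i j := by
  have hz0 : 0 ≤ z := fun k => hν.le.trans ((hνq k).trans (hz k))
  by_cases hl : (F.plug y hy).lin i j = 0
  · obtain ⟨k, -, hk⟩ : ∃ k ∈ Finset.univ, (F.plug y hy).quad i j k * q k ≠ 0 := by
      apply Finset.exists_ne_zero_of_sum_ne_zero
      intro h0
      exact h (by rw [jac_apply, hl, h0]; simp)
    have h1 : κ / 2 ≤ (F.plug y hy).quad i j k :=
      (hquad i (.inl j) (.inl k)).resolve_left (left_ne_zero_of_mul hk)
    have h2 : κ / 2 * ν ≤ (F.plug y hy).quad i j k * z k := by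
      have := (hνq k).trans (hz k)
      gcongr
      exact (F.plug y hy).quad_nonneg _ _ _
    have h3 := (F.plug y hy).quad_le_jac hz0 i j k
    linarith
  · exact (QuadMap.mul_le_lin_plug hκ hν hν1 hlin hquad hy hνy hl).trans
      ((F.plug y hy).lin_le_jac hz0 i j)

/-- A non-zero constant term can come from a single product of two parameters, which is why only
the square of `κ ν` bounds it from below. -/
theorem QuadMap.sq_le_const_plug (hκ : 0 < κ) (hκ1 : κ ≤ 1) (hν : 0 < ν) (hν1 : ν ≤ 1 / 2)
    (hconst : ∀ i, F.const i = 0 ∨ κ ≤ F.const i)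
    (hlin : ∀ i s, F.lin i s = 0 ∨ κ ≤ F.lin i s)
    (hquad : ∀ i s t, F.quad i s t = 0 ∨ κ / 2 ≤ F.quad i s t)
    (hy : 0 ≤ y) (hνy : ∀ k, ν ≤ y k) {i : Fin n} (h : (F.plug y hy).const i ≠ 0) :
    (κ * ν) ^ 2 / 2 ≤ (F.plug y hy).const i := by
  have hκ2 : κ ^ 2 ≤ κ := by
    rw [sq]
    exact mul_le_of_le_one_right hκ.le hκ1
  have hquadmin : (κ * ν) ^ 2 / 2 ≤ κ / 2 * (ν * ν) := by
    have := mul_le_mul_of_nonneg_right hκ2 (mul_nonneg hν.le hν.le)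
    calc (κ * ν) ^ 2 / 2 = κ ^ 2 * (ν * ν) / 2 := by ring
      _ ≤ κ / 2 * (ν * ν) := by linarith
  have hν2 : ν * ν ≤ ν := mul_le_of_le_one_right hν.le (by linarith)
  have hlinmin : κ / 2 * (ν * ν) ≤ κ * ν := by
    have := mul_le_mul_of_nonneg_left hν2 hκ.le
    have := mul_pos hκ hν
    linarith
  have hconstmin : κ * ν ≤ κ := mul_le_of_le_one_right hκ.le (by linarith)
  have hl : ∀ k, 0 ≤ F.lin i (.inr k) * y k := fun k => mul_nonneg (F.lin_nonneg _ _) (hy k)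
  have hq : ∀ k l, 0 ≤ F.quad i (.inr k) (.inr l) * (y k * y l) := fun k l =>
    mul_nonneg (F.quad_nonneg _ _ _) (mul_nonneg (hy k) (hy l))
  have hq' : ∀ k, 0 ≤ ∑ l, F.quad i (.inr k) (.inr l) * (y k * y l) := fun k =>
    Finset.sum_nonneg fun l _ => hq k l
  have hls := Finset.sum_nonneg fun k (_ : k ∈ Finset.univ) => hl k
  have hqs := Finset.sum_nonneg fun k (_ : k ∈ Finset.univ) => hq' k
  have hc0 := F.const_nonneg i
  simp only [plug] at h ⊢
  rcases hconst i with hc | hc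
  · by_cases hlz : ∑ k, F.lin i (.inr k) * y k = 0
    · obtain ⟨k, -, hk⟩ := Finset.exists_ne_zero_of_sum_ne_zero
        (s := Finset.univ) (f := fun k => ∑ l, F.quad i (.inr k) (.inr l) * (y k * y l))
        fun h0 => h (by rw [hc, hlz, h0]; simp)
      obtain ⟨l, -, hkl⟩ := Finset.exists_ne_zero_of_sum_ne_zero hk
      have h1 := (hquad i (.inr k) (.inr l)).resolve_left (left_ne_zero_of_mul hkl)
      have h2 : κ / 2 * (ν * ν) ≤ F.quad i (.inr k) (.inr l) * (y k * y l) := by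
        have := hνy k
        have := hνy l
        have : 0 ≤ y k := hy k
        gcongr
        exact F.quad_nonneg _ _ _
      have h3 := Finset.single_le_sum
        (f := fun l => F.quad i (.inr k) (.inr l) * (y k * y l))
        (fun l _ => hq k l) (Finset.mem_univ l)
      have h4 := Finset.single_le_sum
        (f := fun k => ∑ l, F.quad i (.inr k) (.inr l) * (y k * y l))
        (fun k _ => hq' k) (Finset.mem_univ k)
      linarith
    · obtain ⟨k, -, hk⟩ := Finset.exists_ne_zero_of_sum_ne_zero hlz
      have h1 := (hlin i (.inr k)).resolve_left (left_ne_zero_of_mul hk)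
      have h2 : κ * ν ≤ F.lin i (.inr k) * y k := by
        have := hνy k
        gcongr
        exact F.lin_nonneg _ _
      have h3 := Finset.single_le_sum (f := fun k => F.lin i (.inr k) * y k)
        (fun k _ => hl k) (Finset.mem_univ k)
      linarith
  · linarith

end Alpha

theorem cMin_le {n : ℕ} {σ : Type*} {Q : Fin n → MvPolynomial σ ℝ} (hQ : IsMonotone Q)
    {i : Fin n} {d : σ →₀ ℕ} (h : (Q i).coeff d ≠ 0) : cMin Q ≤ (Q i).coeff d :=
  csInf_le ⟨0, by rintro _ ⟨-, i, d, rfl⟩; exact hQ i d⟩ ⟨h, i, d, rfl⟩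

theorem cMin_pos {n : ℕ} {σ : Type*} {Q : Fin n → MvPolynomial σ ℝ} (hQ : IsMonotone Q)
    {i : Fin n} (h : Q i ≠ 0) : 0 < cMin Q := by
  obtain ⟨d, hd⟩ := MvPolynomial.ne_zero_iff.1 h
  have hfin : {c : ℝ | c ≠ 0 ∧ ∃ i d, (Q i).coeff d = c}.Finite := by
    refine (Set.finite_iUnion fun i : Fin n =>
      (Q i).support.finite_toSet.image fun d => (Q i).coeff d).subset ?_
    rintro _ ⟨hc, i, d, rfl⟩
    exact Set.mem_iUnion.2 ⟨i, d, MvPolynomial.mem_support_iff.2 hc, rfl⟩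
  have hne : {c : ℝ | c ≠ 0 ∧ ∃ i d, (Q i).coeff d = c}.Nonempty := ⟨_, hd, i, d, rfl⟩
  obtain ⟨h0, i, d, h1⟩ := hne.csInf_mem hfin
  exact lt_of_le_of_ne (by rw [cMin, ← h1]; exact hQ i d) (Ne.symm h0)

theorem vMin_le {k : ℕ} (v : Fin k → ℝ) (i : Fin k) : vMin v ≤ v i :=
  ciInf_le (Set.finite_range v).bddBelow i

theorem vMin_pos {k : ℕ} (hk : 1 ≤ k) {v : Fin k → ℝ} (hv : ∀ i, 0 < v i) : 0 < vMin v := by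
  have : Nonempty (Fin k) := ⟨⟨0, hk⟩⟩
  obtain ⟨i, hi⟩ := exists_eq_ciInf_of_finite (f := v)
  rw [vMin, ← hi]
  exact hv i

end MPS

theorem theorem2 (n m : ℕ) (hn : 1 ≤ n) (hm : 1 ≤ m)
    (P : Fin n → MvPolynomial (Fin n ⊕ Fin m) ℝ)
    (hPmono : MPS.IsMonotone P) (hPquad : MPS.IsQuadratic P)
    (y₁ y₂ : Fin m → ℝ)
    (hy₁pos : ∀ j, 0 < y₁ j) (hy₁le : ∀ j, y₁ j ≤ 1)
    (hy₂nonneg : 0 ≤ y₂) (hy₂le : y₂ ≤ y₁)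
    (hsc : MPS.StronglyConnected (MPS.plug P y₁))
    (q₁ : Fin n → ℝ) (hq₁ : MPS.IsLFP (MPS.plug P y₁) q₁)
    (hq₁pos : ∀ i, 0 < q₁ i) (hq₁le : ∀ i, q₁ i ≤ 1)
    (α : ℝ) (hα : α = MPS.alpha P y₁ q₁) :
    ∃ q₂ : Fin n → ℝ, MPS.IsLFP (MPS.plug P y₂) q₂ ∧ 0 ≤ q₂ ∧ q₂ ≤ q₁ ∧
      ‖q₁ - q₂‖ ≤ Real.sqrt (4 * (n : ℝ) * α ^ (-(3 * (n : ℤ) + 1)) *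
        ‖MPS.evalVec P (fun _ => 1)‖ * ‖y₁ - y₂‖) ∧
      (MPS.IsLinear (MPS.plug P y₁) →
        ‖q₁ - q₂‖ ≤ 2 * (n : ℝ) * α ^ (-((n : ℤ) + 2)) *
          ‖MPS.evalVec P (fun _ => 1)‖ * ‖y₁ - y₂‖) ∧
      (∀ ε : ℝ, 0 < ε → ε < 1 → ∀ h g : ℕ,
        ⌈2 + (n : ℝ) * Real.logb 2 (1 / α) + Real.logb 2 (1 / ε)⌉ ≤ (h : ℤ) →
        (h : ℤ) - 1 ≤ (g : ℤ) →
        (∀ k < g, MPS.NewtonDefined (MPS.plug P y₂) (MPS.rnm (MPS.plug P y₂) h k)) ∧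
        ‖q₂ - MPS.rnm (MPS.plug P y₂) h g‖ ≤ ε) := by
  have hy₁ : 0 ≤ y₁ := fun j => (hy₁pos j).le
  let i₀ : Fin n := ⟨0, hn⟩
  obtain ⟨i, hPi⟩ : ∃ i, P i ≠ 0 := by
    by_contra hcon
    push Not at hcon
    have h1 := congrFun hq₁.1.2 i₀
    simp only [MPS.evalVec, MPS.plug, hcon, map_zero] at h1
    exact (hq₁pos i₀).ne' h1
  have hc := MPS.cMin_pos hPmono hPi
  set κ := min 1 (MPS.cMin P)
  set ν := min (MPS.vMin y₁) (1 / 2 * MPS.vMin q₁)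
  have hκ : 0 < κ := lt_min one_pos hc
  have hκ1 : κ ≤ 1 := min_le_left _ _
  have hν : 0 < ν := lt_min (MPS.vMin_pos hm hy₁pos) (by have := MPS.vMin_pos hn hq₁pos; positivity)
  have hνy : ∀ k, ν ≤ y₁ k := fun k => (min_le_left _ _).trans (MPS.vMin_le y₁ k)
  have hνq : ∀ k, ν ≤ q₁ k / 2 := fun k => by
    have h1 := MPS.vMin_le q₁ k
    have h2 : ν ≤ 1 / 2 * MPS.vMin q₁ := min_le_right _ _
    linarith
  have hν1 : ν ≤ 1 / 2 := (hνq i₀).trans (by linarith [hq₁le i₀])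
  have hακν : α = κ * ν := hα
  have hα0 : 0 < α := hακν ▸ mul_pos hκ hν
  have hακ : α ≤ κ := hακν ▸ mul_le_of_le_one_right hκ.le (by linarith)
  have hα2 : α ≤ 1 / 2 := hακν ▸ (mul_le_of_le_one_left hν.le hκ1).trans hν1
  obtain ⟨F, rfl, hconst, hlin, hquad⟩ := MPS.QuadMap.exists_eq_toPoly hκ fun i =>
    MPS.IsQuadraticAbove.of_coeff hκ (hPquad i) fun d hd =>
      (min_le_right _ _).trans (MPS.cMin_le hPmono hd)
  rw [MPS.QuadMap.plug_toPoly F y₁ hy₁] at hsc hq₁ ⊢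
  rw [MPS.QuadMap.plug_toPoly F y₂ hy₂nonneg, MPS.QuadMap.evalVec_toPoly]
  set F₁ := F.plug y₁ hy₁ with hF₁
  set F₂ := F.plug y₂ hy₂nonneg with hF₂
  rw [MPS.QuadMap.isLFP_toPoly_iff] at hq₁
  have hdom : F₂.IsDominatedBy F₁ := F.plug_isDominatedBy hy₁ hy₂nonneg hy₂le
  have hirr : F₁.IsIrreducibleSystem q₁ α :=
    { pos := hq₁pos
      le_one := hq₁le
      isLeast := hq₁
      connected := fun i j => Relation.ReflTransGen.mono
        (fun _ _ hab => F₁.jac_ne_zero_of_dependsOn hq₁pos hab) i j (hsc i j)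
      edge := fun i j hij z hz => hακν ▸
        MPS.QuadMap.mul_le_jac_plug hκ hν (by linarith) hlin hquad hy₁ hνy hνq hij hz
      alpha_pos := hα0
      alpha_le_half := hα2 }
  have hq₁0 : 0 ≤ q₁ := hirr.nonneg
  obtain ⟨q₂, hq₂, hq₂₁⟩ := F₂.exists_isLeastFixedPoint hq₁0
    ((hdom.eval_le hq₁0).trans hirr.eval_eq.le)
  have hq₂0 : 0 ≤ q₂ := hq₂.1.1
  set M := ‖F.eval fun _ => 1‖
  set D := ‖y₁ - y₂‖
  set z := (1 / 2 : ℝ) • (q₂ + q₁) with hz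
  -- The difference of the fixed points solves a linear system with right-hand side
  -- `F(q₂, y₁) - F(q₂, y₂)`.
  have hsys : ∀ i, (q₁ - q₂) i - (F₁.jac z).mulVec (q₁ - q₂) i = F₁.eval q₂ i - F₂.eval q₂ i := by
    intro i
    rw [← F₁.eval_sub_eval_eq_mulVec, hirr.eval_eq, ← congrFun hq₂.1.2 i, Pi.sub_apply]
    ring
  have hlow : (F₁.jac z).mulVec (q₁ - q₂) ≤ q₁ - q₂ := fun i => by
    rw [← sub_nonneg, hsys]
    exact sub_nonneg.2 (hdom.eval_le hq₂0 i)
  have hup : ∀ i, (q₁ - q₂) i - (F₁.jac z).mulVec (q₁ - q₂) i ≤ 2 * M * D := by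
    intro i
    rw [hsys, hF₁, hF₂, MPS.QuadMap.eval_plug, MPS.QuadMap.eval_plug]
    refine (F.eval_sub_eval_le (D := D) ?_ ?_ ?_ ?_ (norm_nonneg _) i).trans ?_
    · rintro (j | k)
      · exact hq₂0 j
      · exact hy₂nonneg k
    · rintro (j | k)
      · exact le_rfl
      · exact hy₂le k
    · rintro (j | k)
      · exact (hq₂₁ j).trans (hq₁le j)
      · exact hy₁le k
    · rintro (j | k)
      · rw [Sum.elim_inl, Sum.elim_inl, sub_self]
        exact norm_nonneg _
      · exact (le_abs_self _).trans (norm_le_pi_norm (y₁ - y₂) k)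
    · have h1 : F.eval (fun _ => 1) i ≤ M :=
        (le_abs_self _).trans (norm_le_pi_norm (F.eval fun _ => 1) i)
      have h2 : 0 ≤ D := norm_nonneg _
      gcongr
  have hM0 : 0 ≤ M := norm_nonneg _
  have hD0 : 0 ≤ D := norm_nonneg _
  have hC : 0 ≤ 2 * M * D := by positivity
  have hδ0 : 0 ≤ q₁ - q₂ := sub_nonneg.2 hq₂₁
  have hzk : ∀ k, z k = (q₂ k + q₁ k) / 2 := fun k => by
    simp only [hz, Pi.smul_apply, Pi.add_apply, smul_eq_mul]
    ring
  have hlinear : F₁.quad = 0 → ∀ i, (q₁ - q₂) i * α ^ (n + 2) ≤ n * (2 * M * D) := fun h0 =>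
    hirr.mul_pow_le_of_quad_eq_zero h0
      (fun i hi => hακν ▸ MPS.QuadMap.sq_le_const_plug hκ hκ1 hν hν1 hconst hlin hquad hy₁ hνy hi)
      (fun k => by rw [hzk]; linarith [show 0 ≤ q₂ k from hq₂0 k])
      (fun k => by rw [hzk]; linarith [hq₂₁ k]) hδ0 hC hup
  refine ⟨q₂, (F₂.isLFP_toPoly_iff q₂).2 hq₂, hq₂0, hq₂₁, ?_, fun hl => ?_,
    fun ε hε _ h g hh hg => ⟨fun k _ => ?_, ?_⟩⟩
  · have hexp : α ^ (-(3 * (n : ℤ) + 1)) = (α ^ (3 * n + 1))⁻¹ := by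
      rw [zpow_neg]
      norm_cast
    refine (pi_norm_le_iff_of_nonneg (Real.sqrt_nonneg _)).2 fun i => ?_
    rw [Real.norm_of_nonneg (hδ0 i)]
    refine Real.le_sqrt_of_sq_le ?_
    have h1 : (q₁ - q₂) i ^ 2 * α ^ (3 * n + 1) ≤ 2 * (n * (2 * M * D)) := by
      by_cases h0 : F₁.quad = 0
      · have h2 := hlinear h0 i
        have h3 : (q₁ - q₂) i ≤ 1 := by
          have : 0 ≤ q₂ i := hq₂0 i
          rw [Pi.sub_apply]
          linarith [hq₁le i]
        have h4 : (q₁ - q₂) i ^ 2 ≤ (q₁ - q₂) i := by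
          rw [sq]
          exact mul_le_of_le_one_right (hδ0 i) h3
        have h5 : α ^ (3 * n + 1) ≤ α ^ (n + 2) :=
          pow_le_pow_of_le_one hα0.le hirr.alpha_le_one (by omega)
        have h6 : (0 : ℝ) ≤ n * (2 * M * D) := by positivity
        calc (q₁ - q₂) i ^ 2 * α ^ (3 * n + 1) ≤ (q₁ - q₂) i * α ^ (n + 2) :=
              mul_le_mul h4 h5 (by positivity) (hδ0 i)
          _ ≤ 2 * (n * (2 * M * D)) := by linarith
      · obtain ⟨a, b, c, habc⟩ : ∃ a b c, F₁.quad a b c ≠ 0 := by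
          by_contra hcon
          push Not at hcon
          exact h0 (funext fun a => funext fun b => funext fun c => hcon a b c)
        have h2 : κ / 2 ≤ F₁.quad a b c := (hquad a (.inl b) (.inl c)).resolve_left habc
        exact hirr.sq_mul_pow_le_of_quad_ne_zero ((by linarith : α / 2 ≤ κ / 2).trans h2)
          hq₂0 hq₂₁ hlow hup i
    rw [hexp]
    calc (q₁ - q₂) i ^ 2 ≤ 2 * (n * (2 * M * D)) / α ^ (3 * n + 1) :=
          (le_div_iff₀ (by positivity)).2 h1
      _ = 4 * n * (α ^ (3 * n + 1))⁻¹ * M * D := by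
          rw [div_eq_mul_inv]
          ring
  · have hexp : α ^ (-((n : ℤ) + 2)) = (α ^ (n + 2))⁻¹ := by
      rw [zpow_neg]
      norm_cast
    rw [hexp]
    refine (pi_norm_le_iff_of_nonneg (by positivity)).2 fun i => ?_
    rw [Real.norm_of_nonneg (hδ0 i)]
    calc (q₁ - q₂) i ≤ n * (2 * M * D) / α ^ (n + 2) :=
          (le_div_iff₀ (by positivity)).2 (hlinear (F₁.quad_eq_zero_of_isLinear hl) i)
      _ = 2 * n * (α ^ (n + 2))⁻¹ * M * D := by
          rw [div_eq_mul_inv]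
          ring
  · exact MPS.newtonDefined_rnm F₂.evalVec_toPoly F₂.jacobian_toPoly hdom hirr hq₂ hq₂₁ h k
  · exact MPS.norm_sub_rnm_le F₂.evalVec_toPoly F₂.jacobian_toPoly hdom hirr hq₂ hq₂₁ hε hh hg
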